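/- **Notation.** $(q)_n=\prod_{j=1}^n(1-q^j)$; $\left[{P\atop N}\right]=\frac{(q)_P}{(q)_N(q)_{P-N}}$ if $P\ge N\ge 0$ and $0$ otherwise. *Partition pairs.* A partition in $(N,M)$ is a sequence of integers $M\ge p_N\ge\cdots\ge p_1\ge 0$ and its weight is $\mathrm{wt}(p)=\sum_i p_i$. For non-negative integers $a,b,\alpha,\beta$ with $a+b>0$, $\alpha+\beta>0$, let $R(N,M,a,b,\alpha,\beta)=\sum q^{\mathrm{wt}(\hat q)+\mathrm{wt}(\hat p)}$, summed over all pairs $(\hat q,\hat p)$ of partitions in $(N,M)$ such that $\hat p_i-\hat q_{i+1-a}\ge 1-\alpha$ and $\hat q_i-\hat p_{i+1-b}\ge 1-\beta$ whenever both subscripts lie in $\{1,\dots,N\}$, and such that: if $a=0$ then $\hat q_1\le\alpha-1$ and $\hat p_N\ge M-\alpha+1$; if $b=0$ then $\hat p_1\le\beta-1$ and $\hat q_N\ge M-\beta+1$. *Continued fractions.* For positive coprime integers $s,r$, or $(s,r)=(1,0)$, the continued fraction of $(s:r)$ is the sequence defined recursively by: it is $()$ for $(1:0)$; otherwise its first term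 $c_1$ is the largest integer with $c_1r\le s$, and the remaining terms form the continued fraction of $(r:s-c_1r)$. In addition $(c_1,\dots,c_{k},1)$ is identified with $(c_1,\dots,c_{k}+1)$ for $k\ge1$. **Theorem.** Let $0<p<p'$ be coprime integers and let $(p':p)$ have continued fraction $(c_1,\dots,c_{t-1},c_t+2)$ with $t\ge1$ and all $c_k\ge0$. Let $1\le u\le t$ and $1\le d\le c_u$, let $r,s$ be such that $(c_1,\dots,c_{u-1},d)$ is the continued fraction of $(s:r)$, and let $M\ge0$ be an integer. Then, coefficientwise as formal power series in $q$, $$\lim_{N\to\infty}R(N,M,r,p-r,s,p'-s)=\frac1{(q)_{2M}}\sum\left(q^{\,n_{u,d}+\sum_{k=1}^{u}\sum_{i=1}^{f_k}n_{k,i}^2+\sum_{k=u+1}^{x}\sum_{i=1}^{f_k}n_{k,i}(n_{k,i}-1)}\prod_{k=1}^{x}\ \prod_{i=1+\delta_{1,k}}^{f_k}\left[{2\left(w_k-\sum_{j=1}^i n_{k,j}\right)+n_{k,i-1}+n_{k,i}\atop n_{k,i-1}-n_{k,i}}\right]\right),$$ where $(f_1,\dots,f_{t+1})=(c_1,\dots,c_{u-1},d,c_u-d,c_{u+1},\dots,c_t)$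 and the (finite) sum is over all sequences $n^{(1)},\dots,n^{(x)}$ with $u\le x\le t+1$ such that, for $1\le k\le x$, $n^{(k)}=(n_{k,1},\dots,n_{k,f_k})$ consists of integers with $n_{k,0}\ge n_{k,1}\ge\cdots\ge n_{k,f_k}\ge0$ and $\mathrm{wt}(n^{(k)}):=\sum_{i=1}^{f_k}n_{k,i}\le w_k$; such that $\mathrm{wt}(n^{(x)})=w_x$; and such that, in addition, $\mathrm{wt}(n^{(u)})<w_u$ if $u<x$, $n_{k,f_k}>0$ if $u<k<x$, and $n_{x,f_x}=0$ if $x<t+1$. Here $$w_1=M;\quad w_k=n_{k-1,f_{k-1}}\ (2\le k\le u);\quad w_{u+1}=w_u-1-\mathrm{wt}(n^{(u)});\quad w_k=n_{k-1,f_{k-1}}-1\ (u+2\le k\le x);$$ $$n_{1,0}=\infty;\quad n_{k,0}=w_{k-1}-\mathrm{wt}(n^{(k-1)})\ (2\le k\le u);\quad n_{u+1,0}=n_{u,f_u}+1;\quad n_{k,0}=w_{k-1}+1-\mathrm{wt}(n^{(k-1)})\ (u+2\le k\le x).$$ -/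

import Mathlib

open Filter Topology
open scoped PowerSeries PowerSeries.WithPiTopology

namespace BurgeTree

/-! ### q-shifted factorials and Gaussian polynomials, as elements of `ℤ⟦X⟧` with `q = X` -/

/-- `(q)_n = (1 - q)(1 - q^2) ⋯ (1 - q^n)`. -/
noncomputable def qFact (n : ℕ) : ℤ⟦X⟧ :=
  ∏ j ∈ Finset.Icc 1 n, (1 - PowerSeries.X ^ j)

/-- `1 / (q)_n`; the constant coefficient of `(q)_n` is `1`, so this is a genuine inverse. -/
noncomputable def qFactInv (n : ℕ) : ℤ⟦X⟧ :=
  PowerSeries.invOfUnit (qFact n) 1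

/-- The Gaussian polynomial `(q)_P / ((q)_N (q)_{P-N})` if `P ≥ N`, and `0` otherwise. -/
noncomputable def gauss (P N : ℕ) : ℤ⟦X⟧ :=
  if N ≤ P then qFact P * qFactInv N * qFactInv (P - N) else 0

/-! ### Restricted partition pairs -/

/-- A partition in `(N, M)`: `N` parts with `M ≥ p_N ≥ ⋯ ≥ p_1 ≥ 0`;
the part `p_i` is the value at the index `i - 1`. -/
abbrev BoxSeq (N M : ℕ) : Type := Fin N → Fin (M + 1)

/-- The part `p_i` for `1 ≤ i ≤ N`. The values `p_0 = 0` and `p_i = M` for `i > N` are conventions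
that are only ever read when the partition has no parts at all. -/
def entry {N M : ℕ} (p : BoxSeq N M) (i : ℕ) : ℤ :=
  if i = 0 then 0 else if h : i - 1 < N then ((p ⟨i - 1, h⟩ : ℕ) : ℤ) else (M : ℤ)

/-- The weight of a partition in `(N, M)`: the sum of its parts. -/
def boxWt {N M : ℕ} (p : BoxSeq N M) : ℕ := ∑ i, (p i : ℕ)

/-- `(q, p)` is a restricted partition pair in `(N₁, M₁) × (N₂, M₂)`,
for the parameters `a, b, α, β`. -/
structure IsRestricted (N₁ M₁ N₂ M₂ a b α β : ℕ) (q : BoxSeq N₁ M₁) (p : BoxSeq N₂ M₂) :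
    Prop where
  monotone_q : Monotone q
  monotone_p : Monotone p
  /-- `p_i - q_{i+1-a} ≥ 1 - α`, whenever both subscripts are meaningful (here `j = i + 1 - a`) -/
  first : ∀ i j : ℕ, 1 ≤ i → i ≤ N₂ → 1 ≤ j → j ≤ N₁ → j + a = i + 1 →
    entry p i - entry q j ≥ 1 - (α : ℤ)
  /-- `q_i - p_{i+1-b} ≥ 1 - β`, whenever both subscripts are meaningful (here `j = i + 1 - b`) -/
  second : ∀ i j : ℕ, 1 ≤ i → i ≤ N₁ → 1 ≤ j → j ≤ N₂ → j + b = i + 1 →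
    entry q i - entry p j ≥ 1 - (β : ℤ)
  special_a : a = 0 → entry q 1 ≤ (α : ℤ) - 1
  special_b : b = 0 → entry p 1 ≤ (β : ℤ) - 1
  special_a' : (a : ℤ) = (N₂ : ℤ) - N₁ → entry p N₂ ≥ (M₁ : ℤ) - α + 1
  special_b' : (b : ℤ) = (N₁ : ℤ) - N₂ → entry q N₁ ≥ (M₂ : ℤ) - β + 1

open Classical in
/-- The generating function of the restricted partition pairs. -/
noncomputable def genFun (N₁ M₁ N₂ M₂ a b α β : ℕ) : ℤ⟦X⟧ :=
  ∑ π : BoxSeq N₁ M₁ × BoxSeq N₂ M₂ with IsRestricted N₁ M₁ N₂ M₂ a b α β π.1 π.2,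
    PowerSeries.X ^ (boxWt π.1 + boxWt π.2)

/-- `R(N, M, a, b, α, β) = R(N, M, N, M, a, b, α, β)`. -/
noncomputable def R (N M a b α β : ℕ) : ℤ⟦X⟧ := genFun N M N M a b α β

/-! ### Continued fractions of pairs -/

/-- The continued fraction of `(s : r)`: it is empty for `r = 0`; otherwise its first term is the
largest `c` with `c r ≤ s`, followed by the continued fraction of `(r : s - c r)`. -/
def contFrac : ℕ → ℕ → List ℕ
  | _, 0 => []
  | s, r + 1 => s / (r + 1) :: contFrac (r + 1) (s % (r + 1))
termination_by _ r => r
decreasing_by exact Nat.mod_lt _ (Nat.succ_pos _)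

/-- `l` is the continued fraction of `(s : r)`, where `s, r` are positive coprime integers or
`(s, r) = (1, 0)`, and where `(c_1, …, c_k, 1)` is equated with `(c_1, …, c_k + 1)` for `k ≥ 1`. -/
def IsContFrac (l : List ℕ) (s r : ℕ) : Prop :=
  0 < s ∧ Nat.Coprime s r ∧
    (contFrac s r = l ∨
      ∃ (l' : List ℕ) (a : ℕ), l = l' ++ [a, 1] ∧ contFrac s r = l' ++ [a + 1])

/-! ### The fermionic sum -/

/-- `(f_1, …, f_{t+1}) = (c_1, …, c_{u-1}, d, c_u - d, c_{u+1}, …, c_t)`. -/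
def fSeq (c : ℕ → ℕ) (u d k : ℕ) : ℕ :=
  if k < u then c k else if k = u then d else if k = u + 1 then c u - d else c (k - 1)

/-- The partition `n^{(k)}`, `1 ≤ k ≤ x`, of the sequence `ν = (n^{(1)}, …, n^{(x)})`. -/
def prt (ν : List (List ℕ)) (k : ℕ) : List ℕ := ν.getD (k - 1) []

/-- The part `n_{k,i}` with `1 ≤ k ≤ x` and `1 ≤ i ≤ f_k`. -/
def part (ν : List (List ℕ)) (k i : ℕ) : ℕ := (prt ν k).getD (i - 1) 0

/-- The pair `(n_{k,0}, w_k)` for `k ≥ 1`, with `n_{1,0} = N` (possibly `∞`) and `w_1 = M`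
(the value at `k = 0` is never used). For an admissible sequence no subtraction below truncates. -/
def bounds (N : ℕ∞) (M : ℕ) (f : ℕ → ℕ) (u : ℕ) (ν : List (List ℕ)) : ℕ → ℕ∞ × ℕ∞
  | 0 => (N, M)
  | 1 => (N, M)
  | k + 2 =>
    -- `last` is `n_{k+1, f_{k+1}}`, `w` is `w_{k+1}`, `wt` is the weight of `n^{(k+1)}`
    let prev := bounds N M f u ν (k + 1)
    let last : ℕ∞ := if f (k + 1) = 0 then prev.1 else (part ν (k + 1) (f (k + 1)) : ℕ∞)
    let w : ℕ∞ := prev.2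
    let wt : ℕ∞ := ((prt ν (k + 1)).sum : ℕ∞)
    if k + 2 ≤ u then (w - wt, last)
    else if k + 2 = u + 1 then (last + 1, w - 1 - wt)
    else (w + 1 - wt, last - 1)

/-- `w_k`. -/
def w (N : ℕ∞) (M : ℕ) (f : ℕ → ℕ) (u : ℕ) (ν : List (List ℕ)) (k : ℕ) : ℕ∞ :=
  (bounds N M f u ν k).2

/-- `n_{k,i}` for `0 ≤ i ≤ f_k`, including `n_{k,0}`. -/
def n (N : ℕ∞) (M : ℕ) (f : ℕ → ℕ) (u : ℕ) (ν : List (List ℕ)) (k i : ℕ) : ℕ∞ :=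
  if i = 0 then (bounds N M f u ν k).1 else (part ν k i : ℕ∞)

/-- The sequences `ν = (n^{(1)}, …, n^{(x)})` of partitions over which the fermionic sum runs;
`x` is the length of `ν`. -/
structure IsAdmissible (N : ℕ∞) (M t : ℕ) (f : ℕ → ℕ) (u : ℕ) (ν : List (List ℕ)) : Prop where
  le_length : u ≤ ν.length
  length_le : ν.length ≤ t + 1
  /-- `n^{(k)}` has `f_k` parts and `n_{k,0} ≥ n_{k,1} ≥ ⋯ ≥ n_{k,f_k} ≥ 0` -/
  length_prt : ∀ k, 1 ≤ k → k ≤ ν.length → (prt ν k).length = f k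
  antitone : ∀ k i, 1 ≤ k → k ≤ ν.length → 1 ≤ i → i ≤ f k →
    n N M f u ν k i ≤ n N M f u ν k (i - 1)
  wt_le : ∀ k, 1 ≤ k → k ≤ ν.length → ((prt ν k).sum : ℕ∞) ≤ w N M f u ν k
  wt_last : ((prt ν ν.length).sum : ℕ∞) = w N M f u ν ν.length
  wt_u : u < ν.length → ((prt ν u).sum : ℕ∞) < w N M f u ν u
  pos : ∀ k, u < k → k < ν.length → 0 < n N M f u ν k (f k)
  zero : ν.length < t + 1 → n N M f u ν ν.length (f ν.length) = 0

/-- The exponent `n_{u,d} + ∑_{k=1}^u ∑_i n_{k,i}^2 + ∑_{k=u+1}^x ∑_i n_{k,i} (n_{k,i} - 1)`. -/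
def qExponent (f : ℕ → ℕ) (u d : ℕ) (ν : List (List ℕ)) : ℕ :=
  part ν u d
    + ∑ k ∈ Finset.Icc 1 u, ∑ i ∈ Finset.Icc 1 (f k), part ν k i ^ 2
    + ∑ k ∈ Finset.Icc (u + 1) ν.length, ∑ i ∈ Finset.Icc 1 (f k), part ν k i * (part ν k i - 1)

/-- The Gaussian `[2 (w_k - ∑_{j=1}^i n_{k,j}) + n_{k,i-1} + n_{k,i}, n_{k,i-1} - n_{k,i}]`.
It is only used where `w_k` and `n_{k,i-1}` are finite. -/
noncomputable def gaussFactor (N : ℕ∞) (M : ℕ) (f : ℕ → ℕ) (u : ℕ) (ν : List (List ℕ))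
    (k i : ℕ) : ℤ⟦X⟧ :=
  gauss
    (2 * ((w N M f u ν k).toNat - ∑ j ∈ Finset.Icc 1 i, part ν k j)
      + (n N M f u ν k (i - 1)).toNat + part ν k i)
    ((n N M f u ν k (i - 1)).toNat - part ν k i)

/-- The summand for `ν`, with the Gaussian for `k = i = 1` removed. -/
noncomputable def term (N : ℕ∞) (M : ℕ) (f : ℕ → ℕ) (u d : ℕ) (ν : List (List ℕ)) : ℤ⟦X⟧ :=
  PowerSeries.X ^ qExponent f u d ν *
    ∏ k ∈ Finset.Icc 1 ν.length, ∏ i ∈ Finset.Icc (if k = 1 then 2 else 1) (f k),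
      gaussFactor N M f u ν k i

end BurgeTree

/-! A restricted pair is a pair of lattice paths that avoid each other and each other's translates
by multiples of `(K, -κ)`, where `K = a + b` and `κ = α + β`. Removing the last step of a suitable
path gives recurrences that determine the generating function. The alternating sum `bosSum` over
translations and reflections satisfies the same recurrences, by Pascal's rule term by term, and the
same boundary conditions, so it equals `R` (`pairGen_eq_bosSum`).

Three identities follow from the alternating form. `R_swap` exchanges widths and heights. `R_burge`
lowers `(α, β)` by `(a, b)` at the cost of a sum over one integer `n` with weight `q^(n^2)` and a
Gaussian; each term of `bosSum` transforms by the `q`-Pfaff–Saalschütz summation. `R_one_zero` turns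
`α = 0` into `α = 1` when `a = 1`.

Burge steps and swaps run the Euclidean algorithm on `(s : r)` and on `(p' - s : p - r)`
simultaneously, each step contributing one part `n_{k,i}`. After `(c_1, …, c_{u-1}, d)` the
parameters are `(1, K - 1, 0, κ)`, where `(κ : K)` is the value of the rest of the continued
fraction. `R_one_zero` and `R_zero_one` lead to the parameters `(0, K, 1, κ - 1)`, and the algorithm
continues on `(κ : K)`. The normalization `S`, in which a power of `q` is divided out, produces the
exponents `n (n - 1)` and the shifts by one for `k > u + 1`. The recursion ends at `S N M 1 2`,
which is `1` for `M = 0` and `0` otherwise.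

So for each finite `N`, `R` is a finite sum over sequences of partitions (`R_eq_sum_lower`). For `N
≥ M` these are the admissible sequences, and `N` enters only through the first Gaussian, which tends
to `1 / (q)_{2M}`. -/

namespace BurgeTree

/-! ### Gaussian polynomials as lattice path counts -/

/-- The Gaussian polynomial `[n + m, n]` at `q`, as a weighted count of lattice paths. -/
def boxGen {A : Type*} [CommRing A] (q : A) : ℕ → ℕ → A
  | 0, _ => 1
  | _ + 1, 0 => 1
  | n + 1, m + 1 => boxGen q (n + 1) m + q ^ (m + 1) * boxGen q n (m + 1)

section CommRing

variable {A : Type*} [CommRing A] (q : A)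

@[simp] theorem boxGen_zero_left (m : ℕ) : boxGen q 0 m = 1 := by
  simp [boxGen]

@[simp] theorem boxGen_zero_right (n : ℕ) : boxGen q n 0 = 1 := by
  cases n <;> simp [boxGen]

theorem boxGen_succ_succ (n m : ℕ) : boxGen q (n + 1) (m + 1) =
    boxGen q (n + 1) m + q ^ (m + 1) * boxGen q n (m + 1) := by
  rw [boxGen]

theorem boxGen_succ_succ' (n m : ℕ) : boxGen q (n + 1) (m + 1) =
    boxGen q n (m + 1) + q ^ (n + 1) * boxGen q (n + 1) m := by
  induction n generalizing m with
  | zero =>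
    induction m with
    | zero => simp [boxGen_succ_succ]
    | succ m ih =>
      have h1 := boxGen_succ_succ q 0 (m + 1)
      have h2 := boxGen_succ_succ q 0 m
      simp only [boxGen_zero_left] at *
      linear_combination h1 + ih - q * h2
  | succ n ihn =>
    induction m with
    | zero =>
      have h1 := boxGen_succ_succ q (n + 1) 0
      have h2 := boxGen_succ_succ q n 0
      have h3 := ihn 0
      simp only [boxGen_zero_right] at *
      linear_combination h1 + q * h3 - h2
    | succ m ihm =>
      linear_combination boxGen_succ_succ q (n + 1) (m + 1) + ihm + q ^ (m + 2) * ihn (m + 1)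
        - boxGen_succ_succ q n (m + 1) - q ^ (n + 2) * boxGen_succ_succ q (n + 1) m

theorem boxGen_comm (n m : ℕ) : boxGen q n m = boxGen q m n := by
  induction n generalizing m with
  | zero => simp
  | succ n ihn =>
    induction m with
    | zero => simp
    | succ m ihm => rw [boxGen_succ_succ, boxGen_succ_succ' q m n, ihm, ihn]

theorem boxGen_succ_mul (k m : ℕ) :
    boxGen q k (m + 1) * (1 - q ^ (m + 1)) = boxGen q k m * (1 - q ^ (k + m + 1)) := by
  cases k with
  | zero => simp
  | succ k =>
    linear_combination boxGen_succ_succ q k m - q ^ (m + 1) * boxGen_succ_succ' q k m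

/-- `(1 - q) ⋯ (1 - q ^ n)` at a general `q`. -/
def qPoch (n : ℕ) : A := ∏ j ∈ Finset.Icc 1 n, (1 - q ^ j)

theorem qPoch_succ (n : ℕ) : qPoch q (n + 1) = qPoch q n * (1 - q ^ (n + 1)) := by
  rw [qPoch, qPoch, Finset.prod_Icc_succ_top (by omega)]

theorem boxGen_mul_qPoch (k m : ℕ) :
    boxGen q k m * qPoch q m = ∏ j ∈ Finset.Icc 1 m, (1 - q ^ (k + j)) := by
  induction m with
  | zero => simp [qPoch]
  | succ m ih =>
    rw [Finset.prod_Icc_succ_top (by omega), ← ih, qPoch_succ]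
    linear_combination qPoch q m * boxGen_succ_mul q k m

theorem boxGen_mul_qPoch_mul_qPoch (k m : ℕ) :
    boxGen q k m * qPoch q k * qPoch q m = qPoch q (k + m) := by
  induction m with
  | zero => simp [qPoch]
  | succ m ih =>
    rw [← add_assoc, qPoch_succ, qPoch_succ, ← ih]
    linear_combination qPoch q m * qPoch q k * boxGen_succ_mul q k m

/-- Both sides are the `q`-multinomial coefficient of `n, m, l`. Cancelling the `q`-factorials is
where `q` must not be a root of unity. -/
theorem boxGen_mul_boxGen [IsDomain A] (hq : ∀ j : ℕ, 0 < j → q ^ j ≠ 1) (n m l : ℕ) :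
    boxGen q n (m + l) * boxGen q m l = boxGen q (n + m) l * boxGen q n m := by
  have hP : ∀ n, qPoch q n ≠ 0 := fun n => Finset.prod_ne_zero_iff.2 fun j hj =>
    sub_ne_zero.2 (hq j (Finset.mem_Icc.1 hj).1).symm
  refine mul_right_cancel₀ (mul_ne_zero (mul_ne_zero (hP n) (hP m)) (hP l)) ?_
  refine mul_right_cancel₀ (mul_ne_zero (hP (m + l)) (hP (n + m))) ?_
  have h1 := boxGen_mul_qPoch_mul_qPoch q n (m + l)
  have h2 := boxGen_mul_qPoch_mul_qPoch q m l
  have h3 := boxGen_mul_qPoch_mul_qPoch q (n + m) l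
  have h4 := boxGen_mul_qPoch_mul_qPoch q n m
  calc _ = (boxGen q n (m + l) * qPoch q n * qPoch q (m + l)) *
        (boxGen q m l * qPoch q m * qPoch q l) * qPoch q (n + m) := by ring
    _ = (boxGen q (n + m) l * qPoch q (n + m) * qPoch q l) *
        (boxGen q n m * qPoch q n * qPoch q m) * qPoch q (m + l) := by
        rw [h1, h2, h3, h4, add_assoc]; ring
    _ = _ := by ring

theorem map_boxGen {A' : Type*} [CommRing A'] (φ : A →+* A') (n m : ℕ) :
    φ (boxGen q n m) = boxGen (φ q) n m := by
  induction n generalizing m with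
  | zero => simp
  | succ n ihn =>
    induction m with
    | zero => simp
    | succ m ihm => simp [boxGen_succ_succ, ihm, ihn]

/-- `boxGen` extended by zero to all integers. -/
def intBox (n m : ℤ) : A := if 0 ≤ n ∧ 0 ≤ m then boxGen q n.toNat m.toNat else 0

@[simp] theorem intBox_natCast (n m : ℕ) : intBox q n m = boxGen q n m := by
  simp [intBox]

theorem intBox_of_neg_left {n : ℤ} (h : n < 0) (m : ℤ) : intBox q n m = 0 :=
  if_neg (by omega)

theorem intBox_of_neg_right (n : ℤ) {m : ℤ} (h : m < 0) : intBox q n m = 0 :=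
  if_neg (by omega)

theorem intBox_comm (n m : ℤ) : intBox q n m = intBox q m n := by
  unfold intBox
  simp only [boxGen_comm q n.toNat, and_comm (a := 0 ≤ n)]

@[simp] theorem intBox_zero_zero : intBox q 0 0 = 1 := by simp [intBox]

theorem intBox_mul_intBox [IsDomain A] (hq : ∀ j : ℕ, 0 < j → q ^ j ≠ 1) {n m l : ℤ}
    (hm : 0 ≤ m) :
    intBox q n (m + l) * intBox q m l = intBox q (n + m) l * intBox q n m := by
  rcases lt_or_ge n 0 with hn | hn
  · simp [intBox_of_neg_left q hn]
  rcases lt_or_ge l 0 with hl | hl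
  · simp [intBox_of_neg_right q _ hl]
  lift n to ℕ using hn
  lift m to ℕ using hm
  lift l to ℕ using hl
  exact_mod_cast boxGen_mul_boxGen q hq n m l

end CommRing

/-! ### The `q`-Vandermonde and `q`-Pfaff–Saalschütz summations. -/

section Field

variable {F : Type*} [Field F] {q : F}

/-- Removal of the last step of a lattice path. -/
theorem intBox_eq_last (n m : ℤ) (h : n ≠ 0 ∨ m ≠ 0) :
    intBox q n m = intBox q n (m - 1) + q ^ m * intBox q (n - 1) m := by
  rcases lt_or_ge n 0 with hn | hn
  · simp [intBox_of_neg_left q hn, intBox_of_neg_left q (show n - 1 < 0 by omega)]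
  rcases lt_or_ge m 0 with hm | hm
  · simp [intBox_of_neg_right q _ hm, intBox_of_neg_right q _ (show m - 1 < 0 by omega)]
  lift n to ℕ using hn
  lift m to ℕ using hm
  cases n with
  | zero =>
    cases m with
    | zero => simp at h
    | succ m =>
      rw [intBox_of_neg_left q (show ((0 : ℕ) : ℤ) - 1 < 0 by omega), Nat.cast_succ,
        add_sub_cancel_right, ← Nat.cast_succ, intBox_natCast, intBox_natCast]
      simp
  | succ n =>
    cases m with
    | zero =>
      rw [intBox_of_neg_right q _ (show ((0 : ℕ) : ℤ) - 1 < 0 by omega), Nat.cast_succ,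
        add_sub_cancel_right, ← Nat.cast_succ, intBox_natCast, intBox_natCast]
      simp
    | succ m =>
      rw [zpow_natCast, Nat.cast_succ, Nat.cast_succ, add_sub_cancel_right, add_sub_cancel_right,
        ← Nat.cast_succ, ← Nat.cast_succ, intBox_natCast, intBox_natCast, intBox_natCast,
        boxGen_succ_succ]

/-- Removal of the first step of a lattice path. -/
theorem intBox_eq_first (n m : ℤ) (h : n ≠ 0 ∨ m ≠ 0) :
    intBox q n m = intBox q (n - 1) m + q ^ n * intBox q n (m - 1) := by
  rw [intBox_comm, intBox_eq_last m n h.symm, intBox_comm q m, intBox_comm q (m - 1)]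

/-- The `q`-Vandermonde summation, cutting lattice paths at an antidiagonal. -/
theorem intBox_eq_sum (hq : q ≠ 0) (X : ℕ) (n m : ℤ) (h : (X : ℤ) ≤ n + m) :
    intBox q n m = ∑ j ∈ Finset.range (X + 1),
      q ^ (((X : ℤ) - j) * (n - j)) * intBox q j (X - j) * intBox q (n - j) (m - X + j) := by
  -- Induction on the number `Y` of steps beyond the cut. For `Y = 0` only `j = n` survives;
  -- otherwise the last step can be removed on both sides.
  obtain ⟨Y, hY⟩ : ∃ Y : ℕ, n + m = X + Y := ⟨(n + m - X).toNat, by omega⟩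
  induction Y generalizing n m with
  | zero =>
    have hz : ∀ j : ℕ, n ≠ j → intBox q (n - j) (m - X + j) = 0 := fun j hj => by
      rcases lt_or_gt_of_ne hj with h | h
      · exact intBox_of_neg_left q (by omega) _
      · exact intBox_of_neg_right q _ (by omega)
    rcases lt_or_ge n 0 with hn | hn
    · rw [intBox_of_neg_left q hn, Finset.sum_eq_zero]
      intro j _
      rw [hz j (by omega), mul_zero]
    rcases lt_or_ge m 0 with hm | hm
    · rw [intBox_of_neg_right q _ hm, Finset.sum_eq_zero]
      intro j hj
      rw [hz j (by rw [Finset.mem_range] at hj; omega), mul_zero]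
    lift n to ℕ using hn
    rw [Finset.sum_eq_single_of_mem n (by rw [Finset.mem_range]; omega)
      (fun j _ hj => by rw [hz j (by omega), mul_zero]),
      show m = X - n by omega]
    simp
  | succ Y ih =>
    rw [intBox_eq_last n m (by omega), ih n (m - 1) (by omega) (by omega),
      ih (n - 1) m (by omega) (by omega), Finset.mul_sum, ← Finset.sum_add_distrib]
    refine Finset.sum_congr rfl fun j _ => ?_
    rw [intBox_eq_last (n - j) (m - X + j) (by omega),
      show m - 1 - (X : ℤ) + j = m - X + j - 1 by ring, show n - 1 - (j : ℤ) = n - j - 1 by ring,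
      show ((X : ℤ) - j) * (n - j) = (X - j) * (n - j - 1) + (X - j) by ring,
      show m = (m - X + j) + (X - j) by ring, zpow_add₀ hq, zpow_add₀ hq]
    rw [show (m - X + j) + (X - j) - X + (j : ℤ) = m - X + j by ring]
    ring

/-- The `q`-Pfaff–Saalschütz summation. -/
theorem saalschutz (hq : q ≠ 0) (hq' : ∀ j : ℕ, 0 < j → q ^ j ≠ 1) (A B C L : ℕ) :
    ∑ m ∈ Finset.range (A + 1), q ^ ((m : ℤ) * (m + C)) *
      intBox q (L - m) (A + B) * intBox q m (A - m) * intBox q (m + C) (B - m - C) =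
    intBox q L (A + C) * intBox q (L + C) (B - C) := by
  set T : ℕ → ℕ → F := fun m k => q ^ ((m : ℤ) * (m + C)) *
    (q ^ (((A : ℤ) - k) * (L - k)) * intBox q (k - m) (A - k) * intBox q (L - k) (B + k)) *
    intBox q m (A - m) * intBox q (m + C) (B - m - C) with hT
  -- Vandermonde for the first Gaussian, cut at the antidiagonal `A - m`; the new summation index is
  -- `k = m + j`.
  have h1 : ∀ m ∈ Finset.range (A + 1), q ^ ((m : ℤ) * (m + C)) *
      intBox q (L - m) (A + B) * intBox q m (A - m) * intBox q (m + C) (B - m - C) =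
      ∑ k ∈ Finset.Ico m (A + 1), T m k := by
    intro m hm
    obtain ⟨D, rfl⟩ : ∃ D, A = m + D := ⟨A - m, by rw [Finset.mem_range] at hm; omega⟩
    rw [Finset.sum_Ico_eq_sum_range, show m + D + 1 - m = D + 1 by omega,
      intBox_eq_sum hq D _ _ (by push_cast; omega), Finset.mul_sum, Finset.sum_mul, Finset.sum_mul]
    refine Finset.sum_congr rfl fun j _ => ?_
    simp only [hT]
    push_cast
    rw [show (m : ℤ) + D - (m + j) = D - j by ring, show (L : ℤ) - (m + j) = L - m - j by ring,
      show (m : ℤ) + D + B - D + j = B + (m + j) by ring, show (m : ℤ) + j - m = j by ring]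
  -- After two multinomial exchanges the sum over `m` is a Vandermonde sum for `(k + C, B - C)` cut
  -- at `k`, read backwards.
  have h2 : ∀ k ∈ Finset.range (A + 1), ∑ m ∈ Finset.range (k + 1), T m k =
      (q ^ (((A : ℤ) - k) * (L - k)) * intBox q k (A - k) * intBox q (L - k) (A + C - A + k)) *
        intBox q (L + C) (B - C) := by
    intro k hk
    rw [Finset.mem_range] at hk
    have h3 := intBox_mul_intBox q hq' (n := L - k) (m := k + C) (l := B - C) (by omega)
    rw [show (k : ℤ) + C + (B - C) = B + k by ring, show (L : ℤ) - k + (k + C) = L + C by ring]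
      at h3
    rw [show (A : ℤ) + C - A + k = k + C by ring, mul_assoc, mul_assoc,
      mul_comm (intBox q (L - k) (k + C)), ← h3, intBox_eq_sum hq k (k + C) _ (by omega),
      Finset.mul_sum, Finset.mul_sum, Finset.mul_sum, ← Finset.sum_range_reflect]
    refine Finset.sum_congr rfl fun j hj => ?_
    rw [Finset.mem_range] at hj
    obtain ⟨m, rfl⟩ : ∃ m, k = j + m := ⟨k - j, by omega⟩
    have h4 := intBox_mul_intBox q hq' (n := m) (m := j) (l := A - (j + m)) (by omega)
    simp only [hT]
    rw [show j + m + 1 - 1 - j = m by omega]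
    push_cast
    rw [show (j : ℤ) + m - m = j by ring, show (j : ℤ) + m - j = m by ring,
      show (j : ℤ) + m + C - j = m + C by ring, show (B : ℤ) - C - (j + m) + j = B - m - C by ring,
      show (A : ℤ) - m = j + (A - (j + m)) by ring]
    rw [add_comm (m : ℤ) j, intBox_comm q m j] at h4
    linear_combination q ^ ((m : ℤ) * (m + C)) * q ^ (((A : ℤ) - (j + m)) * (L - (j + m))) *
      intBox q (L - (j + m)) (B + (j + m)) * intBox q (m + C) (B - m - C) * h4
  rw [Finset.sum_congr rfl h1]
  -- The remaining sum over `k` is once more a Vandermonde sum, for `(L, A + C)` cut at `A`.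
  have h5 := intBox_eq_sum hq A (L : ℤ) (A + C) (by omega)
  rw [h5, Finset.sum_mul, ← Finset.sum_congr rfl h2]
  simp only [Finset.range_eq_Ico]
  rw [Finset.sum_Ico_Ico_comm]

end Field

/-! ### The alternating sum over the affine Weyl group of type `A₁` -/

section Bosonic

variable {F : Type*} [Field F] {q : F}

/-- The contribution of the `l`-th translation to `bosSum`. -/
noncomputable def bosTrans (q : F) (K κ a α N₁ M₁ N₂ M₂ l : ℤ) : F :=
  q ^ (l * κ * (N₁ - N₂ + a) - l * K * α + l ^ 2 * K * κ) *
    intBox q (N₁ + l * K) (M₁ - l * κ) * intBox q (N₂ - l * K) (M₂ + l * κ)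

/-- The contribution of the `l`-th reflection to `bosSum`. -/
noncomputable def bosRefl (q : F) (K κ a α N₁ M₁ N₂ M₂ l : ℤ) : F :=
  q ^ ((α - l * κ) * (N₁ - N₂ + a - l * K)) *
    intBox q (N₁ + a - l * K) (M₁ - α + l * κ) * intBox q (N₂ - a + l * K) (M₂ + α - l * κ)

/-- The (truncated) alternating sum counting pairs of lattice paths ending at `(N₁, M₁)` and
`(N₂, M₂)` that avoid each other and their translates by multiples of `(K, -κ)`. -/
noncomputable def bosSum (q : F) (L : ℕ) (K κ a α N₁ M₁ N₂ M₂ : ℤ) : F :=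
  ∑ l ∈ Finset.Icc (-L : ℤ) L,
    (bosTrans q K κ a α N₁ M₁ N₂ M₂ l - bosRefl q K κ a α N₁ M₁ N₂ M₂ l)

theorem sum_Icc_neg (L : ℕ) (f : ℤ → F) :
    ∑ l ∈ Finset.Icc (-L : ℤ) L, f (-l) = ∑ l ∈ Finset.Icc (-L : ℤ) L, f l :=
  Finset.sum_equiv (Equiv.neg ℤ) (fun i => by simp only [Finset.mem_Icc, Equiv.neg_apply]; omega)
    (fun i _ => rfl)

/-- Removal of the last step of the first path. -/
theorem bosSum_eq_last_left (hq : q ≠ 0) (L : ℕ) {K κ a α N₁ M₁ N₂ M₂ : ℤ} (hK : 0 < K)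
    (hκ : 0 < κ) (hN₁ : 0 ≤ N₁)
    (hM₁ : 0 ≤ M₁) (hN₂ : 0 ≤ N₂) (hM₂ : 0 ≤ M₂) (h0 : N₁ ≠ 0 ∨ M₁ ≠ 0) (h1 : N₂ < N₁ + a)
    (h2 : M₂ < M₁ + (κ - α)) :
    bosSum q L K κ a α N₁ M₁ N₂ M₂ = bosSum q L K κ a α N₁ (M₁ - 1) N₂ M₂ +
      q ^ M₁ * bosSum q L K κ a α (N₁ - 1) M₁ N₂ M₂ := by
  simp only [bosSum]
  rw [Finset.mul_sum, ← Finset.sum_add_distrib]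
  refine Finset.sum_congr rfl fun l _ => ?_
  have hl : l ≤ -1 ∨ l = 0 ∨ 1 ≤ l := by omega
  -- Pascal's rule fails only at the origin; the strict inequalities and `h0` keep every shifted and
  -- reflected end away from it.
  have e1 : N₁ + l * K ≠ 0 ∨ M₁ - l * κ ≠ 0 := by
    rcases hl with hl | rfl | hl
    · right; nlinarith
    · simpa using h0
    · left; nlinarith
  have e2 : N₁ + a - l * K ≠ 0 ∨ M₁ - α + l * κ ≠ 0 := by
    rcases hl with hl | rfl | hl
    · left; nlinarith
    · left; omega
    · right; nlinarith
  unfold bosTrans bosRefl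
  rw [intBox_eq_last _ _ e1, intBox_eq_last _ _ e2]
  have z1 : q ^ (l * κ * (N₁ - N₂ + a) - l * K * α + l ^ 2 * K * κ) * q ^ (M₁ - l * κ) =
      q ^ M₁ * q ^ (l * κ * (N₁ - 1 - N₂ + a) - l * K * α + l ^ 2 * K * κ) := by
    rw [← zpow_add₀ hq, ← zpow_add₀ hq]; congr 1; ring
  have z2 : q ^ ((α - l * κ) * (N₁ - N₂ + a - l * K)) * q ^ (M₁ - α + l * κ) =
      q ^ M₁ * q ^ ((α - l * κ) * (N₁ - 1 - N₂ + a - l * K)) := by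
    rw [← zpow_add₀ hq, ← zpow_add₀ hq]; congr 1; ring
  rw [show N₁ + l * K - 1 = N₁ - 1 + l * K by ring, show N₁ + a - l * K - 1 = N₁ - 1 + a - l * K
    by ring, show M₁ - l * κ - 1 = M₁ - 1 - l * κ by ring,
    show M₁ - α + l * κ - 1 = M₁ - 1 - α + l * κ by ring]
  linear_combination
    intBox q (N₁ - 1 + l * K) (M₁ - l * κ) * intBox q (N₂ - l * K) (M₂ + l * κ) * z1 -
    intBox q (N₁ - 1 + a - l * K) (M₁ - α + l * κ) *
      intBox q (N₂ - a + l * K) (M₂ + α - l * κ) * z2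

/-- Removal of the last step of the second path. -/
theorem bosSum_eq_last_right (hq : q ≠ 0) (L : ℕ) {K κ a α N₁ M₁ N₂ M₂ : ℤ} (hK : 0 < K)
    (hκ : 0 < κ) (hN₁ : 0 ≤ N₁)
    (hM₁ : 0 ≤ M₁) (hN₂ : 0 ≤ N₂) (hM₂ : 0 ≤ M₂) (h0 : N₂ ≠ 0 ∨ M₂ ≠ 0) (h1 : N₁ < N₂ + (K - a))
    (h2 : M₁ < M₂ + α) :
    bosSum q L K κ a α N₁ M₁ N₂ M₂ = bosSum q L K κ a α N₁ M₁ N₂ (M₂ - 1) +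
      q ^ M₂ * bosSum q L K κ a α N₁ M₁ (N₂ - 1) M₂ := by
  simp only [bosSum]
  rw [Finset.mul_sum, ← Finset.sum_add_distrib]
  refine Finset.sum_congr rfl fun l _ => ?_
  have hl : l ≤ -1 ∨ l = 0 ∨ 1 ≤ l := by omega
  have e1 : N₂ - l * K ≠ 0 ∨ M₂ + l * κ ≠ 0 := by
    rcases hl with hl | rfl | hl
    · left; nlinarith
    · simpa using h0
    · right; nlinarith
  have e2 : N₂ - a + l * K ≠ 0 ∨ M₂ + α - l * κ ≠ 0 := by
    rcases hl with hl | rfl | hl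
    · right; nlinarith
    · right; omega
    · left; nlinarith
  unfold bosTrans bosRefl
  rw [intBox_eq_last _ _ e1, intBox_eq_last _ _ e2]
  have z1 : q ^ (l * κ * (N₁ - N₂ + a) - l * K * α + l ^ 2 * K * κ) * q ^ (M₂ + l * κ) =
      q ^ M₂ * q ^ (l * κ * (N₁ - (N₂ - 1) + a) - l * K * α + l ^ 2 * K * κ) := by
    rw [← zpow_add₀ hq, ← zpow_add₀ hq]; congr 1; ring
  have z2 : q ^ ((α - l * κ) * (N₁ - N₂ + a - l * K)) * q ^ (M₂ + α - l * κ) =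
      q ^ M₂ * q ^ ((α - l * κ) * (N₁ - (N₂ - 1) + a - l * K)) := by
    rw [← zpow_add₀ hq, ← zpow_add₀ hq]; congr 1; ring
  rw [show N₂ - l * K - 1 = N₂ - 1 - l * K by ring, show N₂ - a + l * K - 1 = N₂ - 1 - a + l * K
    by ring, show M₂ + l * κ - 1 = M₂ - 1 + l * κ by ring,
    show M₂ + α - l * κ - 1 = M₂ - 1 + α - l * κ by ring]
  linear_combination
    intBox q (N₁ + l * K) (M₁ - l * κ) * intBox q (N₂ - 1 - l * K) (M₂ + l * κ) * z1 -
    intBox q (N₁ + a - l * K) (M₁ - α + l * κ) *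
      intBox q (N₂ - 1 - a + l * K) (M₂ + α - l * κ) * z2

/-- The sum vanishes if the first path and the translated second path have the same end. -/
theorem bosSum_eq_zero_of_end_left (L : ℕ) {K κ a α N₁ M₁ N₂ M₂ : ℤ} (h1 : N₂ = N₁ + a)
    (h2 : M₁ = M₂ + α) : bosSum q L K κ a α N₁ M₁ N₂ M₂ = 0 := by
  refine Finset.sum_eq_zero fun l _ => ?_
  subst h1 h2
  unfold bosTrans bosRefl
  rw [show l * κ * (N₁ - (N₁ + a) + a) - l * K * α + l ^ 2 * K * κ =
    (α - l * κ) * (N₁ - (N₁ + a) + a - l * K) by ring,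
    show M₂ + α - α + l * κ = M₂ + l * κ by ring, show N₁ + a - a + l * K = N₁ + l * K by ring]
  ring

/-- The sum vanishes if the second path and the translated first path have the same end. -/
theorem bosSum_eq_zero_of_end_right {L : ℕ} {K κ a α N₁ M₁ N₂ M₂ : ℤ} (hκ : 0 < κ) (hα : 0 ≤ α)
    (hL : M₁ < L) (h1 : N₁ = N₂ + (K - a)) (h2 : M₂ = M₁ + (κ - α)) :
    bosSum q L K κ a α N₁ M₁ N₂ M₂ = 0 := by
  have key : ∀ l, bosRefl q K κ a α N₁ M₁ N₂ M₂ (l + 1) = bosTrans q K κ a α N₁ M₁ N₂ M₂ l := by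
    intro l
    subst h1 h2
    unfold bosTrans bosRefl
    rw [show (α - (l + 1) * κ) * (N₂ + (K - a) - N₂ + a - (l + 1) * K) =
        l * κ * (N₂ + (K - a) - N₂ + a) - l * K * α + l ^ 2 * K * κ by ring,
      show N₂ + (K - a) + a - (l + 1) * K = N₂ - l * K by ring,
      show M₁ - α + (l + 1) * κ = M₁ + (κ - α) + l * κ by ring,
      show N₂ - a + (l + 1) * K = N₂ + (K - a) + l * K by ring,
      show M₁ + (κ - α) + α - (l + 1) * κ = M₁ - l * κ by ring]
    ring
  -- Matching translation `l` with reflection `l + 1` leaves one unpaired term at each end of the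
  -- truncated range; both vanish because `L > M₁`.
  have e1 : bosTrans q K κ a α N₁ M₁ N₂ M₂ L = 0 := by
    rw [bosTrans, intBox_of_neg_right q (N₁ + L * K) (by nlinarith), mul_zero, zero_mul]
  have e2 : bosRefl q K κ a α N₁ M₁ N₂ M₂ (-L) = 0 := by
    rw [bosRefl, intBox_of_neg_right q (N₁ + a - -L * K) (by nlinarith), mul_zero, zero_mul]
  have s1 : Finset.Icc (-L : ℤ) L = insert (L : ℤ) (Finset.Ico (-L : ℤ) L) := by
    ext x; simp only [Finset.mem_Icc, Finset.mem_insert, Finset.mem_Ico]; omega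
  have s2 : Finset.Icc (-L : ℤ) L = insert (-L : ℤ) (Finset.Ioc (-L : ℤ) L) := by
    ext x; simp only [Finset.mem_Icc, Finset.mem_insert, Finset.mem_Ioc]; omega
  rw [bosSum, Finset.sum_sub_distrib, sub_eq_zero]
  nth_rw 1 [s1]
  rw [s2, Finset.sum_insert (by simp), Finset.sum_insert (by simp), e1, e2, zero_add, zero_add]
  refine Finset.sum_equiv (Equiv.addRight 1) (fun i => ?_) (fun i _ => (key i).symm)
  simp only [Finset.mem_Ico, Equiv.coe_addRight, Finset.mem_Ioc]; omega

/-- The sum vanishes if the two paths have the same start. -/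
theorem bosSum_eq_zero_of_start (L : ℕ) (K κ N₁ M₁ N₂ M₂ : ℤ) :
    bosSum q L K κ 0 0 N₁ M₁ N₂ M₂ = 0 := by
  rw [bosSum, Finset.sum_sub_distrib, sub_eq_zero, ← sum_Icc_neg]
  refine Finset.sum_congr rfl fun l _ => ?_
  unfold bosTrans bosRefl
  rw [show -l * κ * (N₁ - N₂ + 0) - -l * K * 0 + (-l) ^ 2 * K * κ =
    (0 - l * κ) * (N₁ - N₂ + 0 - l * K) by ring]
  congr 2 <;> ring_nf

/-- Removal of the first step of the second path. -/
theorem bosSum_eq_first (hq : q ≠ 0) (L : ℕ) {K κ N M : ℤ} (hK : 0 < K) (hκ : 0 < κ)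
    (hN : 0 ≤ N) (hM : 1 ≤ M) :
    bosSum q L K κ 1 0 N M N M = bosSum q L K κ 0 0 N M (N - 1) M +
      q ^ N * bosSum q L K κ 1 1 N M N (M - 1) := by
  simp only [bosSum]
  rw [Finset.mul_sum, ← Finset.sum_add_distrib]
  refine Finset.sum_congr rfl fun l _ => ?_
  have hl : l ≤ -1 ∨ l = 0 ∨ 1 ≤ l := by omega
  have e1 : N - l * K ≠ 0 ∨ M + l * κ ≠ 0 := by
    rcases hl with hl | rfl | hl
    · left; nlinarith
    · right; omega
    · right; nlinarith
  have e2 : N + 1 - l * K ≠ 0 ∨ M - 0 + l * κ ≠ 0 := by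
    rcases hl with hl | rfl | hl
    · left; nlinarith
    · right; omega
    · right; nlinarith
  unfold bosTrans bosRefl
  rw [intBox_eq_first _ _ e1, intBox_eq_first _ _ e2]
  have z1 : q ^ (l * κ * (N - N + 1) - l * K * 0 + l ^ 2 * K * κ) * q ^ (N - l * K) =
      q ^ N * q ^ (l * κ * (N - N + 1) - l * K * 1 + l ^ 2 * K * κ) := by
    rw [← zpow_add₀ hq, ← zpow_add₀ hq]; congr 1; ring
  have z2 : q ^ ((0 - l * κ) * (N - N + 1 - l * K)) * q ^ (N + 1 - l * K) =
      q ^ N * q ^ ((1 - l * κ) * (N - N + 1 - l * K)) := by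
    rw [← zpow_add₀ hq, ← zpow_add₀ hq]; congr 1; ring
  rw [show N - l * K - 1 = N - 1 - l * K by ring, show N + 1 - l * K - 1 = N + 0 - l * K
    by ring, show M + l * κ - 1 = M - 1 + l * κ by ring,
    show M - 0 + l * κ - 1 = M - 1 + l * κ by ring, show N - (N - 1) + 0 = N - N + 1 by ring,
    show N - 1 - 0 + l * K = N - 1 + l * K by ring, show M - 1 + 1 - l * κ = M + 0 - l * κ by ring]
  linear_combination
    intBox q (N + l * K) (M - l * κ) * intBox q (N - l * K) (M - 1 + l * κ) * z1 -
    intBox q (N + 1 - l * K) (M - 1 + l * κ) * intBox q (N - 1 + l * K) (M + 0 - l * κ) * z2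

/-- Two steps are forced. The wrong first step of the second path would make the starts coincide,
and the wrong last step of the first path would make the ends coincide; both sums vanish. -/
theorem bosSum_one_zero (hq : q ≠ 0) (L : ℕ) {K κ N M : ℤ} (hK : 0 < K) (hκ : 0 < κ)
    (hN : 0 ≤ N) (hM : 0 ≤ M) :
    bosSum q L K κ 1 0 N (M + 1) N (M + 1) = q ^ N * bosSum q L K κ 1 1 N M N M := by
  rw [bosSum_eq_first hq L hK hκ hN (by omega), bosSum_eq_zero_of_start, add_sub_cancel_right,
    bosSum_eq_last_left hq L hK hκ hN (by omega) hN hM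
      (by omega) (by omega) (by omega),
    bosSum_eq_zero_of_end_left (N₁ := N - 1) L (by ring) rfl]
  simp

/-- By symmetry of the Gaussians, translation `-l` on one side matches translation `l` on the other,
while reflections match with the same `l`. -/
theorem bosSum_swap (L : ℕ) (K κ a α N M : ℤ) :
    bosSum q L K κ a α N M N M = bosSum q L κ K α a M N M N := by
  rw [bosSum, bosSum, Finset.sum_sub_distrib, Finset.sum_sub_distrib, ← sum_Icc_neg]
  congr 1 <;> refine Finset.sum_congr rfl fun l _ => ?_
  · unfold bosTrans
    rw [intBox_comm q (M + l * κ), intBox_comm q (M - l * κ)]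
    ring_nf
  · unfold bosRefl
    rw [intBox_comm q (M + α - l * κ), intBox_comm q (M - α + l * κ)]
    ring_nf

theorem bosTrans_eq_zero (K κ a α N₁ M₁ N₂ M₂ l : ℤ)
    (h : N₁ + l * K < 0 ∨ M₁ - l * κ < 0 ∨ N₂ - l * K < 0 ∨ M₂ + l * κ < 0) :
    bosTrans q K κ a α N₁ M₁ N₂ M₂ l = 0 := by
  unfold bosTrans
  rcases h with h | h | h | h
  · simp [intBox_of_neg_left q h]
  · simp [intBox_of_neg_right q _ h]
  · simp [intBox_of_neg_left q h]
  · simp [intBox_of_neg_right q _ h]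

theorem bosRefl_eq_zero (K κ a α N₁ M₁ N₂ M₂ l : ℤ)
    (h : N₁ + a - l * K < 0 ∨ M₁ - α + l * κ < 0 ∨ N₂ - a + l * K < 0 ∨ M₂ + α - l * κ < 0) :
    bosRefl q K κ a α N₁ M₁ N₂ M₂ l = 0 := by
  unfold bosRefl
  rcases h with h | h | h | h
  · simp [intBox_of_neg_left q h]
  · simp [intBox_of_neg_right q _ h]
  · simp [intBox_of_neg_left q h]
  · simp [intBox_of_neg_right q _ h]

/-- The base case: the first path is empty. -/
theorem bosSum_zero_zero_left (L : ℕ) {K κ a α N₂ M₂ : ℤ} (hK : 0 < K) (hκ : 0 < κ)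
    (h1 : N₂ < a) (h2 : M₂ < κ - α) :
    bosSum q L K κ a α 0 0 N₂ M₂ = intBox q N₂ M₂ := by
  have hT : ∀ l ≠ 0, bosTrans q K κ a α 0 0 N₂ M₂ l = 0 := fun l hl =>
    bosTrans_eq_zero _ _ _ _ _ _ _ _ _ <| by
    rcases lt_or_gt_of_ne hl with hl | hl
    · left; nlinarith
    · right; left; nlinarith
  have hR : ∀ l, bosRefl q K κ a α 0 0 N₂ M₂ l = 0 := fun l =>
    bosRefl_eq_zero _ _ _ _ _ _ _ _ _ <| by
    rcases lt_or_ge 0 l with hl | hl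
    · right; right; right; nlinarith
    · right; right; left; nlinarith
  simp only [bosSum, hR, sub_zero]
  rw [Finset.sum_eq_single_of_mem 0 (by simp) (fun l _ hl => hT l hl)]
  simp [bosTrans]

/-- The base case: the second path is empty. -/
theorem bosSum_zero_zero_right (L : ℕ) {K κ a α N₁ M₁ : ℤ} (hK : 0 < K) (hκ : 0 < κ)
    (h1 : N₁ < K - a) (h2 : M₁ < α) :
    bosSum q L K κ a α N₁ M₁ 0 0 = intBox q N₁ M₁ := by
  have hT : ∀ l ≠ 0, bosTrans q K κ a α N₁ M₁ 0 0 l = 0 := fun l hl =>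
    bosTrans_eq_zero _ _ _ _ _ _ _ _ _ <| by
    rcases lt_or_gt_of_ne hl with hl | hl
    · right; right; right; nlinarith
    · right; right; left; nlinarith
  have hR : ∀ l, bosRefl q K κ a α N₁ M₁ 0 0 l = 0 := fun l =>
    bosRefl_eq_zero _ _ _ _ _ _ _ _ _ <| by
    rcases lt_or_ge 0 l with hl | hl
    · left; nlinarith
    · right; left; nlinarith
  simp only [bosSum, hR, sub_zero]
  rw [Finset.sum_eq_single_of_mem 0 (by simp) (fun l _ hl => hT l hl)]
  simp [bosTrans]

/-- This and the next three lemmas dispose of the recurrence term in which a path has lost a step it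
did not have: every Gaussian product then has a negative argument. -/
theorem bosSum_neg_left_fst (L : ℕ) {K κ a α N₁ M₁ N₂ M₂ : ℤ} (hK : 0 < K) (haK : a ≤ K)
    (h1 : N₁ = -1) (h2 : N₂ < a) : bosSum q L K κ a α N₁ M₁ N₂ M₂ = 0 := by
  refine Finset.sum_eq_zero fun l _ => ?_
  rw [bosTrans_eq_zero, bosRefl_eq_zero, sub_zero]
  · rcases (by omega : l ≤ 0 ∨ 1 ≤ l) with hl | hl
    · right; right; left; nlinarith
    · left; nlinarith
  · rcases lt_or_ge 0 l with hl | hl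
    · right; right; left; nlinarith
    · left; nlinarith

theorem bosSum_neg_left_snd (L : ℕ) {K κ a α N₁ M₁ N₂ M₂ : ℤ} (hκ : 0 < κ) (hα : 0 ≤ α)
    (h1 : M₁ = -1) (h2 : M₂ < κ - α) : bosSum q L K κ a α N₁ M₁ N₂ M₂ = 0 := by
  refine Finset.sum_eq_zero fun l _ => ?_
  rw [bosTrans_eq_zero, bosRefl_eq_zero, sub_zero]
  · rcases lt_or_ge 0 l with hl | hl
    · right; right; right; nlinarith
    · right; left; nlinarith
  · rcases lt_or_ge l 0 with hl | hl
    · right; right; right; nlinarith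
    · right; left; nlinarith

theorem bosSum_neg_right_fst (L : ℕ) {K κ a α N₁ M₁ N₂ M₂ : ℤ} (hK : 0 < K) (ha : 0 ≤ a)
    (h1 : N₂ = -1) (h2 : N₁ < K - a) : bosSum q L K κ a α N₁ M₁ N₂ M₂ = 0 := by
  refine Finset.sum_eq_zero fun l _ => ?_
  rw [bosTrans_eq_zero, bosRefl_eq_zero, sub_zero]
  · rcases lt_or_ge 0 l with hl | hl
    · left; nlinarith
    · right; right; left; nlinarith
  · rcases lt_or_ge l 0 with hl | hl
    · left; nlinarith
    · right; right; left; nlinarith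

theorem bosSum_neg_right_snd (L : ℕ) {K κ a α N₁ M₁ N₂ M₂ : ℤ} (hκ : 0 < κ) (hακ : α ≤ κ)
    (h1 : M₂ = -1) (h2 : M₁ < α) : bosSum q L K κ a α N₁ M₁ N₂ M₂ = 0 := by
  refine Finset.sum_eq_zero fun l _ => ?_
  rw [bosTrans_eq_zero, bosRefl_eq_zero, sub_zero]
  · rcases (by omega : l ≤ 0 ∨ 1 ≤ l) with hl | hl
    · right; left; nlinarith
    · right; right; right; nlinarith
  · rcases lt_or_ge 0 l with hl | hl
    · right; left; nlinarith
    · right; right; right; nlinarith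

end Bosonic

/-! ### Burge's transformation of the alternating sum. -/

section Burge

variable {F : Type*} [Field F] {q : F}

/-- This is `saalschutz` in centred variables. With `N = x + D`, `M = x + y + E` and `n = x + m`,
its parameters are `A = E + 2y`, `B = E + 2x`, `C = 2x`, `L = D`; terms outside the common range
vanish. -/
theorem saalschutz_int_of_nonneg (hq : q ≠ 0) (hq' : ∀ j : ℕ, 0 < j → q ^ j ≠ 1) (N M x y : ℕ) :
    ∑ n ∈ Finset.range (M + 1), q ^ ((n : ℤ) ^ 2 - x ^ 2) * intBox q (N - n) (2 * M) *
      (intBox q (n - x) (M - n + y) * intBox q (n + x) (M - n - y)) =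
    intBox q (N - x) (M + (x + y)) * intBox q (N + x) (M - (x + y)) := by
  have hz : ∀ n : ℕ, n < x ∨ M < n + y → intBox q (n - x) (M - n + y) *
      intBox q (n + x) (M - n - y) = 0 := by
    rintro n (h | h)
    · rw [intBox_of_neg_left q (by omega), zero_mul]
    · rw [intBox_of_neg_right q (n + x : ℤ) (by omega), mul_zero]
  rcases lt_or_ge N x with hN | hN
  · rw [intBox_of_neg_left q (by omega), zero_mul]
    refine Finset.sum_eq_zero fun n _ => ?_
    rcases lt_or_ge n x with h | h
    · rw [hz n (Or.inl h), mul_zero]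
    · rw [intBox_of_neg_left q (show (N - n : ℤ) < 0 by omega), mul_zero, zero_mul]
  rcases lt_or_ge M (x + y) with hM | hM
  · rw [intBox_of_neg_right q (N + x : ℤ) (by omega), mul_zero]
    exact Finset.sum_eq_zero fun n _ => by rw [hz n (by omega), mul_zero]
  obtain ⟨D, rfl⟩ := Nat.exists_eq_add_of_le hN
  obtain ⟨E, rfl⟩ := Nat.exists_eq_add_of_le hM
  have h := saalschutz hq hq' (E + 2 * y) (E + 2 * x) (2 * x) D
  rw [show x + y + E + 1 = x + (E + y + 1) by ring, Finset.sum_range_add,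
    Finset.sum_eq_zero (s := Finset.range x)
      (fun n hn => by rw [hz n (Or.inl (Finset.mem_range.1 hn)), mul_zero]), zero_add]
  rw [show E + 2 * y + 1 = E + y + 1 + y by ring, Finset.sum_range_add,
    Finset.sum_eq_zero (s := Finset.range y) (fun m _ => by
      rw [intBox_of_neg_right q (((E + y + 1 + m : ℕ) : ℤ) + (2 * x : ℕ)) (by push_cast; omega),
        mul_zero]), add_zero] at h
  push_cast at h ⊢
  rw [show (x : ℤ) + D - x = D by ring, show (x : ℤ) + y + E + (x + y) = E + 2 * y + 2 * x by ring,
    show (x : ℤ) + D + x = D + 2 * x by ring, show (x : ℤ) + y + E - (x + y) = E + 2 * x - 2 * x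
    by ring, ← h]
  refine Finset.sum_congr rfl fun m _ => ?_
  rw [show ((x : ℤ) + m) ^ 2 - x ^ 2 = m * (m + 2 * x) by ring,
    show (x : ℤ) + D - (x + m) = D - m by ring,
    show 2 * ((x : ℤ) + y + E) = E + 2 * y + (E + 2 * x) by ring,
    show (x : ℤ) + m - x = m by ring, show (x : ℤ) + y + E - (x + m) + y = E + 2 * y - m by ring,
    show (x : ℤ) + m + x = m + 2 * x by ring,
    show (x : ℤ) + y + E - (x + m) - y = E + 2 * x - m - 2 * x by ring]
  ring

/-- Both sides are invariant under `(x, y) ↦ (-x, -y)`, so only the case of nonnegative `x, y` needs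
the summation formula. -/
theorem saalschutz_int (hq : q ≠ 0) (hq' : ∀ j : ℕ, 0 < j → q ^ j ≠ 1) (N M : ℕ) {x y : ℤ}
    (h : 0 ≤ x ∧ 0 ≤ y ∨ x ≤ 0 ∧ y ≤ 0) :
    ∑ n ∈ Finset.range (M + 1), q ^ ((n : ℤ) ^ 2) * intBox q (N - n) (2 * M) *
      (intBox q (n - x) (M - n + y) * intBox q (n + x) (M - n - y)) =
    q ^ (x ^ 2) * (intBox q (N - x) (M + (x + y)) * intBox q (N + x) (M - (x + y))) := by
  have key : ∀ x y : ℕ, ∑ n ∈ Finset.range (M + 1), q ^ ((n : ℤ) ^ 2) * intBox q (N - n) (2 * M) *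
      (intBox q (n - x) (M - n + y) * intBox q (n + x) (M - n - y)) =
      q ^ ((x : ℤ) ^ 2) *
        (intBox q (N - x) (M + (x + y)) * intBox q (N + x) (M - (x + y))) := by
    intro x y
    rw [← saalschutz_int_of_nonneg hq hq', Finset.mul_sum]
    refine Finset.sum_congr rfl fun n _ => ?_
    rw [show (n : ℤ) ^ 2 = x ^ 2 + (n ^ 2 - x ^ 2) by ring, zpow_add₀ hq]
    ring_nf
  rcases h with ⟨hx, hy⟩ | ⟨hx, hy⟩
  · lift x to ℕ using hx
    lift y to ℕ using hy
    exact key x y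
  · obtain ⟨x, rfl⟩ : ∃ k : ℕ, x = -k := ⟨x.natAbs, by omega⟩
    obtain ⟨y, rfl⟩ : ∃ k : ℕ, y = -k := ⟨y.natAbs, by omega⟩
    have h := key x y
    rw [neg_sq, show (N : ℤ) - -x = N + x by ring, show (N : ℤ) + -x = N - x by ring,
      show (M : ℤ) + (-x + -y) = M - (x + y) by ring, show (M : ℤ) - (-x + -y) = M + (x + y)
      by ring, mul_comm (intBox q (N + x : ℤ) _), ← h]
    refine Finset.sum_congr rfl fun n _ => ?_
    rw [show (n : ℤ) - -x = n + x by ring, show (n : ℤ) + -x = n - x by ring,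
      show (M : ℤ) - n + -y = M - n - y by ring, show (M : ℤ) - n - -y = M - n + y by ring]
    ring

/-- The summation formula of Burge for the alternating sums. -/
theorem bosSum_burge (hq : q ≠ 0) (hq' : ∀ j : ℕ, 0 < j → q ^ j ≠ 1) (L N M : ℕ) {K κ a α : ℤ}
    (ha : 0 ≤ a) (haK : a ≤ K) (hα : 0 ≤ α) (hακ : α ≤ κ) :
    bosSum q L K (κ + K) a (α + a) N M N M = ∑ n ∈ Finset.range (M + 1),
      q ^ ((n : ℤ) ^ 2) * intBox q (N - n) (2 * M) * bosSum q L K κ a α n (M - n) n (M - n) := by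
  simp only [bosSum, Finset.mul_sum]
  rw [Finset.sum_comm]
  refine Finset.sum_congr rfl fun l _ => ?_
  have hl : l ≤ -1 ∨ l = 0 ∨ 1 ≤ l := by omega
  have h1 := saalschutz_int hq hq' N M (x := l * K) (y := l * κ) (by
    rcases hl with hl | rfl | hl
    · right; constructor <;> nlinarith
    · simp
    · left; constructor <;> nlinarith)
  -- Since `0 ≤ a ≤ K` and `0 ≤ α ≤ κ`, the numbers `a - l K` and `α - l κ` never have opposite
  -- signs.
  have h2 := saalschutz_int hq hq' N M (x := a - l * K) (y := α - l * κ) (by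
    rcases hl with hl | rfl | hl
    · left; constructor <;> nlinarith
    · left; simp [ha, hα]
    · right; constructor <;> nlinarith)
  simp only [mul_sub, Finset.sum_sub_distrib]
  congr 1
  · rw [bosTrans, show l * (κ + K) * (N - N + a) - l * K * (α + a) + l ^ 2 * K * (κ + K) =
      (l * κ * a - l * K * α + l ^ 2 * K * κ) + (l * K) ^ 2 by ring, zpow_add₀ hq,
      show (M : ℤ) - l * (κ + K) = M - (l * K + l * κ) by ring,
      show (M : ℤ) + l * (κ + K) = M + (l * K + l * κ) by ring]
    rw [mul_assoc, mul_assoc, mul_comm (intBox q (N + l * K : ℤ) _), ← h1, Finset.mul_sum]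
    refine Finset.sum_congr rfl fun n _ => ?_
    rw [bosTrans, show l * κ * ((n : ℤ) - n + a) = l * κ * a by ring]
    ring
  · rw [bosRefl, show (α + a - l * (κ + K)) * ((N : ℤ) - N + a - l * K) =
      (α - l * κ) * (a - l * K) + (a - l * K) ^ 2 by ring, zpow_add₀ hq,
      show (M : ℤ) - (α + a) + l * (κ + K) = M - (a - l * K + (α - l * κ)) by ring,
      show (M : ℤ) + (α + a) - l * (κ + K) = M + (a - l * K + (α - l * κ)) by ring,
      show (N : ℤ) + a - l * K = N + (a - l * K) by ring,
      show (N : ℤ) - a + l * K = N - (a - l * K) by ring]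
    rw [mul_assoc, mul_assoc, mul_comm (intBox q (N + (a - l * K) : ℤ) _), ← h2, Finset.mul_sum]
    refine Finset.sum_congr rfl fun n _ => ?_
    rw [bosRefl, show (α - l * κ) * ((n : ℤ) - n + a - l * K) = (α - l * κ) * (a - l * K) by ring,
      show (n : ℤ) + a - l * K = n + (a - l * K) by ring,
      show (n : ℤ) - a + l * K = n - (a - l * K) by ring,
      show (M : ℤ) - n - α + l * κ = M - n - (α - l * κ) by ring,
      show (M : ℤ) - n + α - l * κ = M - n + (α - l * κ) by ring]
    ring

end Burge

/-! ### Restricted partition pairs as pairs of lattice paths -/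

/-- A partition in `(N, M)`, extended by `f 0 = 0` and `f i = M` for `i > N`. -/
structure IsPath (N M : ℕ) (f : ℕ → ℕ) : Prop where
  zero : f 0 = 0
  mono : Monotone f
  eq_top : ∀ i, N < i → f i = M

theorem IsPath.le {N M : ℕ} {f : ℕ → ℕ} (h : IsPath N M f) (i : ℕ) : f i ≤ M := by
  rw [← h.eq_top (max i (N + 1)) (by omega)]
  exact h.mono (by omega)

theorem finite_isPath (N M : ℕ) : {f | IsPath N M f}.Finite := by
  refine (Set.finite_range fun (p : Fin (N + 1) → Fin (M + 1)) (i : ℕ) =>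
    if h : i < N + 1 then (p ⟨i, h⟩ : ℕ) else M).subset fun f hf => ?_
  refine ⟨fun i => ⟨f i, Nat.lt_succ_of_le (hf.le i)⟩, funext fun i => ?_⟩
  by_cases h : i < N + 1
  · simp [h]
  · simp [h, hf.eq_top i (by omega)]

/-- The lattice path of a partition lies weakly above the translate by `(a, -α)` of another. -/
def Above (N₁ N₂ a α : ℕ) (f h : ℕ → ℕ) : Prop :=
  ∀ i j, 1 ≤ j → j ≤ N₁ + 1 → i ≤ N₂ → j + a = i + 1 → f j < h i + α

/-- Restricted pairs of extended partitions in `(N₁, M₁) × (N₂, M₂)`. -/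
def pairSet (a b α β N₁ M₁ N₂ M₂ : ℕ) : Set ((ℕ → ℕ) × (ℕ → ℕ)) :=
  {π | IsPath N₁ M₁ π.1 ∧ IsPath N₂ M₂ π.2 ∧ Above N₁ N₂ a α π.1 π.2 ∧ Above N₂ N₁ b β π.2 π.1}

theorem finite_pairSet (a b α β N₁ M₁ N₂ M₂ : ℕ) : (pairSet a b α β N₁ M₁ N₂ M₂).Finite :=
  ((finite_isPath N₁ M₁).prod (finite_isPath N₂ M₂)).subset fun _ h => ⟨h.1, h.2.1⟩

/-- The weight of an extended partition. -/
def pathWt (N : ℕ) (f : ℕ → ℕ) : ℕ := ∑ i ∈ Finset.Icc 1 N, f i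

/-- The generating function of restricted pairs of extended partitions. -/
noncomputable def pairGen {A : Type*} [CommRing A] (q : A) (a b α β N₁ M₁ N₂ M₂ : ℕ) : A :=
  ∑ᶠ π ∈ pairSet a b α β N₁ M₁ N₂ M₂, q ^ (pathWt N₁ π.1 + pathWt N₂ π.2)

/-- The generating function of all extended partitions. -/
noncomputable def pathGen {A : Type*} [CommRing A] (q : A) (N M : ℕ) : A :=
  ∑ᶠ f ∈ {f | IsPath N M f}, q ^ pathWt N f

/-- Lowering the final height of a path whose last step is vertical. -/
def cap (N M : ℕ) (f : ℕ → ℕ) (i : ℕ) : ℕ := if i ≤ N then f i else M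

theorem cap_of_le {N M i : ℕ} (f : ℕ → ℕ) (h : i ≤ N) : cap N M f i = f i := if_pos h

theorem pathWt_cap (N M : ℕ) (f : ℕ → ℕ) : pathWt N (cap N M f) = pathWt N f :=
  Finset.sum_congr rfl fun _ hi => cap_of_le f (Finset.mem_Icc.1 hi).2

theorem cap_cap (N M M' : ℕ) (f : ℕ → ℕ) : cap N M (cap N M' f) = cap N M f := by
  funext i
  unfold cap
  split_ifs <;> rfl

theorem IsPath.cap_eq {N M : ℕ} {f : ℕ → ℕ} (h : IsPath N M f) : cap N M f = f := by
  funext i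
  unfold cap
  split_ifs with hi
  · rfl
  · exact (h.eq_top i (by omega)).symm

theorem IsPath.cap {N M M' : ℕ} {f : ℕ → ℕ} (h : IsPath N M f) (hM : f N ≤ M') :
    IsPath N M' (cap N M' f) where
  zero := by rw [cap_of_le f (Nat.zero_le N), h.zero]
  mono i j hij := by
    unfold BurgeTree.cap
    split_ifs with h1 h2 h2
    · exact h.mono hij
    · exact (h.mono h1).trans hM
    · omega
    · exact le_rfl
  eq_top _ hi := if_neg (by omega)

/-- Dropping a final horizontal step does not change the function, because extended partitions are
constant `M` beyond their last part. -/
theorem isPath_iff_of_eq {N M : ℕ} {f : ℕ → ℕ} :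
    IsPath N M f ↔ IsPath (N + 1) M f ∧ f (N + 1) = M := by
  constructor
  · intro h
    exact ⟨⟨h.zero, h.mono, fun i hi => h.eq_top i (by omega)⟩, h.eq_top _ (by omega)⟩
  · rintro ⟨h, h'⟩
    refine ⟨h.zero, h.mono, fun i hi => ?_⟩
    rcases Nat.lt_or_ge (N + 1) i with hi' | hi'
    · exact h.eq_top i hi'
    · rwa [show i = N + 1 by omega]

theorem pathWt_succ (N : ℕ) (f : ℕ → ℕ) : pathWt (N + 1) f = pathWt N f + f (N + 1) :=
  Finset.sum_Icc_succ_top (by omega) f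

/-! ### Recurrences for lattice paths and for pairs of them. -/

section Recurrences

variable {A : Type*} [CommRing A] (q : A)

/-- The common shape of the recurrences: `P` says that the last step is vertical and `e` removes it;
otherwise the last step is horizontal and the same function represents the shorter path. -/
theorem finsum_path_split {X : Type*} {S S₁ S₂ : Set X} (hS : S.Finite) {W W₁ W₂ : X → A}
    (P : X → Prop) (e : X → X) (h₁ : Set.BijOn e (S ∩ {x | P x}) S₁)
    (hw₁ : ∀ x ∈ S, P x → W x = W₁ (e x)) (h₂ : ∀ x, x ∈ S ∧ ¬ P x ↔ x ∈ S₂)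
    (hw₂ : ∀ x ∈ S₂, W x = W₂ x) :
    ∑ᶠ x ∈ S, W x = ∑ᶠ x ∈ S₁, W₁ x + ∑ᶠ x ∈ S₂, W₂ x := by
  rw [← finsum_mem_inter_add_sdiff {x | P x} hS]
  congr 1
  · exact finsum_mem_eq_of_bijOn e h₁ fun x hx => hw₁ x hx.1 hx.2
  · exact finsum_mem_congr (Set.ext h₂) hw₂

theorem bijOn_cap (N M : ℕ) :
    Set.BijOn (cap N M) ({f | IsPath N (M + 1) f} ∩ {f | f N ≤ M}) {f | IsPath N M f} := by
  refine ⟨fun f hf => hf.1.cap hf.2, fun f hf g hg h => ?_,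
    fun f hf => ⟨cap N (M + 1) f, ⟨?_, ?_⟩, ?_⟩⟩
  · rw [← hf.1.cap_eq, ← hg.1.cap_eq, ← cap_cap N (M + 1) M f, h, cap_cap]
  · exact IsPath.cap hf ((hf.le N).trans (Nat.le_succ M))
  · change cap N (M + 1) f N ≤ M
    rw [cap_of_le f le_rfl]
    exact hf.le N
  · rw [cap_cap, hf.cap_eq]

theorem pathGen_eq (N M : ℕ) : pathGen q N M = boxGen q N M := by
  have hzero : ∀ M, pathGen q 0 M = 1 := by
    intro M
    rw [pathGen, show {f | IsPath 0 M f} = {fun i => if i = 0 then 0 else M} by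
      ext f
      simp only [Set.mem_ofPred_eq, Set.mem_singleton_iff]
      constructor
      · intro h
        funext i
        split_ifs with hi
        · rw [hi, h.zero]
        · exact h.eq_top i (by omega)
      · rintro rfl
        refine ⟨by simp, fun i j hij => ?_, fun i hi => if_neg (by omega)⟩
        split_ifs <;> omega, finsum_mem_singleton]
    simp [pathWt]
  induction N generalizing M with
  | zero => rw [hzero, boxGen_zero_left]
  | succ N ihN =>
    induction M with
    | zero =>
      rw [boxGen_zero_right, pathGen, show {f | IsPath (N + 1) 0 f} = {fun _ => 0} by
        ext f
        simp only [Set.mem_ofPred_eq, Set.mem_singleton_iff]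
        constructor
        · intro h
          funext i
          exact Nat.le_zero.1 (h.le i)
        · rintro rfl
          exact ⟨rfl, monotone_const, fun _ _ => rfl⟩, finsum_mem_singleton]
      simp [pathWt]
    | succ M ihM =>
      rw [boxGen_succ_succ, ← ihM, ← ihN, pathGen, pathGen, pathGen,
        mul_finsum_mem' _ _ (finite_isPath _ _)]
      refine finsum_path_split (finite_isPath _ _) (fun f => f (N + 1) ≤ M) (cap (N + 1) M)
        (bijOn_cap _ _) (fun f _ _ => by rw [pathWt_cap]) (fun f => ?_) (fun f hf => ?_)
      · simp only [Set.mem_ofPred_eq, isPath_iff_of_eq (N := N)]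
        refine and_congr_right fun hf => ?_
        have := hf.le (N + 1)
        omega
      · rw [pathWt_succ, (isPath_iff_of_eq.1 hf).2, pow_add, mul_comm]

/-- The longer path carries extra conditions at `j = N₁ + 2` and `i = N₁ + 1`. By `h1` the former
never arises, and by `h2` the latter holds automatically. -/
theorem pairSet_succ_iff {a b α β N₁ M₁ N₂ M₂ : ℕ} (h1 : N₂ < N₁ + 1 + a) (h2 : M₂ < M₁ + β)
    (π : (ℕ → ℕ) × (ℕ → ℕ)) :
    (π ∈ pairSet a b α β (N₁ + 1) M₁ N₂ M₂ ∧ π.1 (N₁ + 1) = M₁) ↔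
      π ∈ pairSet a b α β N₁ M₁ N₂ M₂ := by
  obtain ⟨f, h⟩ := π
  simp only [pairSet, Set.mem_ofPred_eq, isPath_iff_of_eq (N := N₁)]
  constructor
  · rintro ⟨⟨hf, hh, c1, c2⟩, hM⟩
    exact ⟨⟨hf, hM⟩, hh, fun i j hj hj' hi e => c1 i j hj (by omega) hi e,
      fun i j hj hj' hi e => c2 i j hj hj' (by omega) e⟩
  · rintro ⟨⟨hf, hM⟩, hh, c1, c2⟩
    refine ⟨⟨hf, hh, fun i j hj hj' hi e => c1 i j hj (by omega) hi e,
      fun i j hj hj' hi e => ?_⟩, hM⟩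
    rcases Nat.lt_or_ge N₁ i with hi' | hi'
    · rw [show i = N₁ + 1 by omega, hM]
      exact (hh.le j).trans_lt h2
    · exact c2 i j hj hj' hi' e

/-- Capping alters the first path only beyond `N₁`, where by `h1` no condition reads it. -/
theorem bijOn_cap_pair {a b α β N₁ M₁ N₂ M₂ : ℕ} (h1 : N₂ < N₁ + a) :
    Set.BijOn (Prod.map (cap N₁ M₁) id)
      (pairSet a b α β N₁ (M₁ + 1) N₂ M₂ ∩ {π | π.1 N₁ ≤ M₁}) (pairSet a b α β N₁ M₁ N₂ M₂) := by
  have habove : ∀ (M : ℕ) (f h : ℕ → ℕ), Above N₁ N₂ a α f h → Above N₁ N₂ a α (cap N₁ M f) h :=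
    fun M f h c i j hj hj' hi e => by rw [cap_of_le f (by omega)]; exact c i j hj hj' hi e
  have habove' : ∀ (M : ℕ) (f h : ℕ → ℕ), Above N₂ N₁ b β h f → Above N₂ N₁ b β h (cap N₁ M f) :=
    fun M f h c i j hj hj' hi e => by rw [cap_of_le f hi]; exact c i j hj hj' hi e
  have hb := bijOn_cap N₁ M₁
  refine ⟨fun π hπ => ⟨hπ.1.1.cap hπ.2, hπ.1.2.1, habove _ _ _ hπ.1.2.2.1,
    habove' _ _ _ hπ.1.2.2.2⟩, fun π hπ ρ hρ h => ?_, fun π hπ => ?_⟩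
  · have h1 := congrArg Prod.fst h
    have h2 := congrArg Prod.snd h
    exact Prod.ext (hb.injOn ⟨hπ.1.1, hπ.2⟩ ⟨hρ.1.1, hρ.2⟩ h1) h2
  · refine ⟨(cap N₁ (M₁ + 1) π.1, π.2), ⟨⟨hπ.1.cap ((hπ.1.le N₁).trans (Nat.le_succ _)), hπ.2.1,
      habove _ _ _ hπ.2.2.1, habove' _ _ _ hπ.2.2.2⟩, ?_⟩, ?_⟩
    · change cap N₁ (M₁ + 1) π.1 N₁ ≤ M₁
      rw [cap_of_le _ le_rfl]
      exact hπ.1.le N₁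
    · refine Prod.ext ?_ rfl
      change cap N₁ M₁ (cap N₁ (M₁ + 1) π.1) = π.1
      rw [cap_cap, hπ.1.cap_eq]

theorem pairGen_succ_succ {a b α β N₁ M₁ N₂ M₂ : ℕ} (h1 : N₂ < N₁ + 1 + a)
    (h2 : M₂ < M₁ + 1 + β) :
    pairGen q a b α β (N₁ + 1) (M₁ + 1) N₂ M₂ = pairGen q a b α β (N₁ + 1) M₁ N₂ M₂ +
      q ^ (M₁ + 1) * pairGen q a b α β N₁ (M₁ + 1) N₂ M₂ := by
  rw [pairGen, pairGen, pairGen, mul_finsum_mem' _ _ (finite_pairSet _ _ _ _ _ _ _ _)]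
  refine finsum_path_split (finite_pairSet _ _ _ _ _ _ _ _) (fun π => π.1 (N₁ + 1) ≤ M₁) _
    (bijOn_cap_pair h1) (fun π _ _ => ?_) (fun π => ?_) (fun π hπ => ?_)
  · simp [pathWt_cap]
  · rw [← pairSet_succ_iff h1 h2]
    refine and_congr_right fun hπ => ?_
    have := hπ.1.le (N₁ + 1)
    omega
  · rw [pathWt_succ, ((pairSet_succ_iff h1 h2 π).2 hπ).2]
    ring

theorem pairGen_zero_succ {a b α β M₁ N₂ M₂ : ℕ} (h1 : N₂ < a) :
    pairGen q a b α β 0 (M₁ + 1) N₂ M₂ = pairGen q a b α β 0 M₁ N₂ M₂ := by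
  rw [pairGen, pairGen]
  refine finsum_mem_eq_of_bijOn (Prod.map (cap 0 M₁) id) ?_ (fun π _ => by simp [pathWt_cap])
  have h := bijOn_cap_pair (b := b) (α := α) (β := β) (M₁ := M₁) (M₂ := M₂)
    (show N₂ < 0 + a by omega)
  rwa [Set.inter_eq_left.2] at h
  intro π hπ
  simp [hπ.1.zero]

theorem pairGen_succ_zero {a b α β N₁ N₂ M₂ : ℕ} (h1 : N₂ < N₁ + 1 + a) (h2 : M₂ < β) :
    pairGen q a b α β (N₁ + 1) 0 N₂ M₂ = pairGen q a b α β N₁ 0 N₂ M₂ := by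
  rw [pairGen, pairGen]
  have h := pairSet_succ_iff (b := b) (α := α) h1 (show M₂ < 0 + β by omega)
  refine finsum_mem_congr (Set.ext fun π => ?_) (fun π hπ => ?_)
  · rw [← h]
    exact ⟨fun hπ => ⟨hπ, Nat.le_zero.1 (hπ.1.le _)⟩, fun hπ => hπ.1⟩
  · rw [pathWt_succ, ((h π).2 hπ).2]
    rfl

theorem pairGen_zero_zero {a b α β N₂ M₂ : ℕ} (h1 : N₂ < a) (h2 : M₂ < β) :
    pairGen q a b α β 0 0 N₂ M₂ = boxGen q N₂ M₂ := by
  rw [← pathGen_eq, pathGen, pairGen]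
  refine finsum_mem_eq_of_bijOn Prod.snd ⟨fun π hπ => hπ.2.1, fun π hπ ρ hρ h => ?_,
    fun f hf => ?_⟩ (fun π _ => by simp [pathWt])
  · refine Prod.ext (funext fun i => ?_) h
    rw [Nat.le_zero.1 (hπ.1.le i), Nat.le_zero.1 (hρ.1.le i)]
  · refine ⟨(fun _ => 0, f), ⟨⟨rfl, monotone_const, fun _ _ => rfl⟩, hf, ?_, ?_⟩, rfl⟩
    · intro i j _ _ _ _
      omega
    · intro i j _ _ _ _
      exact (hf.le j).trans_lt (by simpa using h2)

theorem pairGen_swap (a b α β N₁ M₁ N₂ M₂ : ℕ) :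
    pairGen q a b α β N₁ M₁ N₂ M₂ = pairGen q b a β α N₂ M₂ N₁ M₁ := by
  rw [pairGen, pairGen]
  refine finsum_mem_eq_of_bijOn Prod.swap ⟨fun π hπ => ⟨hπ.2.1, hπ.1, hπ.2.2.2, hπ.2.2.1⟩,
    Prod.swap_injective.injOn, fun π hπ => ⟨π.swap, ⟨hπ.2.1, hπ.1, hπ.2.2.2, hπ.2.2.1⟩,
      Prod.swap_swap π⟩⟩ (fun π _ => ?_)
  simp [add_comm]

theorem pairGen_eq_zero {a b α β N₁ M₁ N₂ M₂ : ℕ} (h1 : N₂ = N₁ + a) (h2 : M₁ = M₂ + α) :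
    pairGen q a b α β N₁ M₁ N₂ M₂ = 0 := by
  rw [pairGen, finsum_mem_congr (t := ∅) _ fun _ _ => rfl, finsum_mem_empty]
  refine Set.eq_empty_of_forall_notMem fun π hπ => ?_
  have := hπ.2.2.1 N₂ (N₁ + 1) (by omega) le_rfl le_rfl (by omega)
  rw [hπ.1.eq_top _ (by omega)] at this
  have := hπ.2.1.le N₂
  omega

theorem map_pairGen {A' : Type*} [CommRing A'] (φ : A →+* A') (a b α β N₁ M₁ N₂ M₂ : ℕ) :
    φ (pairGen q a b α β N₁ M₁ N₂ M₂) = pairGen (φ q) a b α β N₁ M₁ N₂ M₂ := by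
  refine (φ.toAddMonoidHom.map_finsum_mem _ (finite_pairSet _ _ _ _ _ _ _ _)).trans ?_
  simp [pairGen]

end Recurrences

/-! ### Pairs of paths are counted by the alternating sum. -/

section Main

variable {F : Type*} [Field F] {q : F}

/-- Induction on the total number of steps. The inequalities `d1`–`d4` confine the ends to the
region where both sides obey the same recurrences; at its corners both sides vanish. -/
theorem pairGen_eq_bosSum (hq : q ≠ 0) {a b α β : ℕ} (hK : 0 < a + b) (hκ : 0 < α + β)
    (N₁ M₁ N₂ M₂ L : ℕ) (hL : M₁ < L) (d1 : N₂ ≤ N₁ + a) (d2 : M₁ ≤ M₂ + α) (d3 : N₁ ≤ N₂ + b)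
    (d4 : M₂ ≤ M₁ + β) :
    pairGen q a b α β N₁ M₁ N₂ M₂ = bosSum q L (a + b) (α + β) a α N₁ M₁ N₂ M₂ := by
  obtain ⟨D, hD⟩ : ∃ D, N₁ + M₁ + N₂ + M₂ = D := ⟨_, rfl⟩
  induction D using Nat.strong_induction_on generalizing N₁ M₁ N₂ M₂ with
  | _ D ih =>
  by_cases c1 : N₂ = N₁ + a ∧ M₁ = M₂ + α
  · rw [pairGen_eq_zero q c1.1 c1.2,
      bosSum_eq_zero_of_end_left L (by omega) (by omega)]
  by_cases c2 : N₁ = N₂ + b ∧ M₂ = M₁ + β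
  · rw [pairGen_swap, pairGen_eq_zero q c2.1 c2.2,
      bosSum_eq_zero_of_end_right (by omega) (by omega) (by omega) (by omega) (by omega)]
  -- The form `(α + β) N + (a + b) M` is constant along the period `(a + b, -(α + β))`. It compares
  -- the first end with the second end moved by `(-a, α)`; the path that is ahead can lose its last
  -- step, since equality in a constraint would give one of the excluded corners.
  have hor : (N₂ < N₁ + a ∧ M₂ < M₁ + β) ∨ (N₁ < N₂ + b ∧ M₁ < M₂ + α) := by
    rcases le_total ((α + β) * (N₂ : ℤ) + (a + b) * M₂ + (a + b) * α - (α + β) * a)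
      ((α + β) * N₁ + (a + b) * M₁) with h | h
    · refine Or.inl ⟨lt_of_le_of_ne d1 fun e => c1 ⟨e, ?_⟩, lt_of_le_of_ne d4 fun e => c2 ⟨?_, e⟩⟩
      · subst e
        push_cast at h
        have : (a + b : ℤ) * (M₂ + α) ≤ (a + b) * M₁ := by linarith
        have := le_of_mul_le_mul_left this (by omega)
        omega
      · subst e
        push_cast at h
        have : (α + β : ℤ) * (N₂ + b) ≤ (α + β) * N₁ := by linarith
        have := le_of_mul_le_mul_left this (by omega)
        omega
    · refine Or.inr ⟨lt_of_le_of_ne d3 fun e => c2 ⟨e, ?_⟩, lt_of_le_of_ne d2 fun e => c1 ⟨?_, e⟩⟩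
      · subst e
        push_cast at h
        have : (a + b : ℤ) * (M₁ + β) ≤ (a + b) * M₂ := by linarith
        have := le_of_mul_le_mul_left this (by omega)
        omega
      · subst e
        push_cast at h
        have : (α + β : ℤ) * (N₁ + a) ≤ (α + β) * N₂ := by linarith
        have := le_of_mul_le_mul_left this (by omega)
        omega
  rcases hor with ⟨h1, h2⟩ | ⟨h1, h2⟩
  · by_cases h0 : N₁ = 0 ∧ M₁ = 0
    · obtain ⟨rfl, rfl⟩ := h0
      rw [pairGen_zero_zero q (by omega) (by omega), Nat.cast_zero,
        bosSum_zero_zero_left L (by omega) (by omega) (by omega) (by omega),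
        intBox_natCast]
    rw [bosSum_eq_last_left hq L (by omega) (by omega) (by omega) (by omega)
        (by omega) (by omega) (by omega) (by omega) (by omega)]
    cases N₁ with
    | zero =>
      obtain ⟨M₁, rfl⟩ := Nat.exists_eq_succ_of_ne_zero (show M₁ ≠ 0 by omega)
      rw [bosSum_neg_left_fst (N₁ := ((0 : ℕ) : ℤ) - 1) L (by omega) (by omega) (by omega)
        (by omega), pairGen_zero_succ q (by omega), Nat.cast_succ, add_sub_cancel_right,
        ih _ (by omega) 0 M₁ N₂ M₂ (by omega) (by omega) (by omega) (by omega) (by omega) rfl]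
      simp
    | succ N₁ =>
      cases M₁ with
      | zero =>
        rw [bosSum_neg_left_snd (M₁ := ((0 : ℕ) : ℤ) - 1) L (by omega) (by omega) (by omega)
          (by omega), pairGen_succ_zero q (by omega) (by omega), Nat.cast_succ,
          add_sub_cancel_right,
          ih _ (by omega) N₁ 0 N₂ M₂ (by omega) (by omega) (by omega) (by omega) (by omega) rfl]
        simp
      | succ M₁ =>
        rw [pairGen_succ_succ q (by omega) (by omega),
          ih _ (by omega) N₁ (M₁ + 1) N₂ M₂ (by omega) (by omega) (by omega) (by omega) (by omega)
            rfl,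
          ih _ (by omega) (N₁ + 1) M₁ N₂ M₂ (by omega) (by omega) (by omega) (by omega) (by omega)
            rfl, zpow_natCast]
        simp
  · by_cases h0 : N₂ = 0 ∧ M₂ = 0
    · obtain ⟨rfl, rfl⟩ := h0
      rw [pairGen_swap, pairGen_zero_zero q (by omega) (by omega), Nat.cast_zero,
        bosSum_zero_zero_right L (by omega) (by omega) (by omega) (by omega),
        intBox_natCast]
    rw [bosSum_eq_last_right hq L (by omega) (by omega) (by omega) (by omega)
        (by omega) (by omega) (by omega) (by omega) (by omega), pairGen_swap]
    cases N₂ with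
    | zero =>
      obtain ⟨M₂, rfl⟩ := Nat.exists_eq_succ_of_ne_zero (show M₂ ≠ 0 by omega)
      rw [bosSum_neg_right_fst (N₂ := ((0 : ℕ) : ℤ) - 1) L (by omega) (by omega) (by omega)
        (by omega), pairGen_zero_succ q (by omega), Nat.cast_succ, add_sub_cancel_right,
        pairGen_swap,
        ih _ (by omega) N₁ M₁ 0 M₂ (by omega) (by omega) (by omega) (by omega) (by omega) rfl]
      simp
    | succ N₂ =>
      cases M₂ with
      | zero =>
        rw [bosSum_neg_right_snd (M₂ := ((0 : ℕ) : ℤ) - 1) L (by omega) (by omega) (by omega)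
          (by omega), pairGen_succ_zero q (by omega) (by omega), Nat.cast_succ,
          add_sub_cancel_right, pairGen_swap,
          ih _ (by omega) N₁ M₁ N₂ 0 (by omega) (by omega) (by omega) (by omega) (by omega) rfl]
        simp
      | succ M₂ =>
        rw [pairGen_succ_succ q (by omega) (by omega), pairGen_swap, pairGen_swap q b a β α N₂,
          ih _ (by omega) N₁ M₁ N₂ (M₂ + 1) (by omega) (by omega) (by omega) (by omega) (by omega)
            rfl,
          ih _ (by omega) N₁ M₁ (N₂ + 1) M₂ (by omega) (by omega) (by omega) (by omega) (by omega)
            rfl, zpow_natCast]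
        simp

end Main

/-! ### Identities between the series `R` -/

/-- The extension of a partition in `(N, M)` by `p_0 = 0` and `p_i = M` for `i > N`. -/
def extend {N M : ℕ} (p : BoxSeq N M) (i : ℕ) : ℕ :=
  if i = 0 then 0 else if h : i - 1 < N then p ⟨i - 1, h⟩ else M

theorem entry_eq {N M : ℕ} (p : BoxSeq N M) (i : ℕ) : entry p i = extend p i := by
  unfold entry extend
  split_ifs <;> simp

theorem extend_zero {N M : ℕ} (p : BoxSeq N M) : extend p 0 = 0 := if_pos rfl

theorem extend_succ {N M : ℕ} (p : BoxSeq N M) (i : Fin N) : extend p (i + 1) = p i := by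
  simp [extend]

theorem extend_of_lt {N M i : ℕ} (p : BoxSeq N M) (h : N < i) : extend p i = M := by
  rw [extend, if_neg (by omega), dif_neg (by omega)]

theorem isPath_extend {N M : ℕ} {p : BoxSeq N M} (h : Monotone p) : IsPath N M (extend p) where
  zero := extend_zero p
  mono i j hij := by
    unfold extend
    split_ifs with h1 h2 h3 h4
    any_goals omega
    exact h (by simp only [Fin.mk_le_mk]; omega)
  eq_top _ hi := extend_of_lt p hi

theorem extend_injective {N M : ℕ} : Function.Injective (extend (N := N) (M := M)) := by
  intro p p' h
  funext i
  have := congrFun h (i + 1)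
  rw [extend_succ, extend_succ] at this
  exact Fin.ext this

theorem IsPath.exists_extend {N M : ℕ} {f : ℕ → ℕ} (h : IsPath N M f) :
    ∃ p : BoxSeq N M, Monotone p ∧ extend p = f := by
  refine ⟨fun i => ⟨f (i + 1), Nat.lt_succ_of_le (h.le _)⟩, fun i j hij => ?_, funext fun i => ?_⟩
  · exact h.mono (by simpa using hij)
  · rcases Nat.eq_zero_or_pos i with rfl | hi
    · rw [extend_zero, h.zero]
    · unfold extend
      rw [if_neg (by omega)]
      split_ifs with h1
      · simp only
        congr 1
        omega
      · exact (h.eq_top i (by omega)).symm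

theorem pathWt_eq_sum_range (N : ℕ) (f : ℕ → ℕ) :
    pathWt N f = ∑ i ∈ Finset.range N, f (i + 1) := by
  induction N with
  | zero => simp [pathWt]
  | succ N ih => rw [pathWt_succ, Finset.sum_range_succ, ih]

theorem pathWt_extend {N M : ℕ} (p : BoxSeq N M) : pathWt N (extend p) = boxWt p := by
  rw [pathWt_eq_sum_range, ← Fin.sum_univ_eq_sum_range (fun i => extend p (i + 1)) N]
  exact Finset.sum_congr rfl fun i _ => extend_succ p i

/-- With `p_0 = 0` and `p_{N+1} = M`, the extra conditions for `a = 0` and `b = 0` become the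
ordinary inequalities at the two ends of the extended partitions. -/
theorem isRestricted_iff {N M a b α β : ℕ} (q p : BoxSeq N M) :
    IsRestricted N M N M a b α β q p ↔ Monotone q ∧ Monotone p ∧
      Above N N a α (extend q) (extend p) ∧ Above N N b β (extend p) (extend q) := by
  constructor
  · intro h
    refine ⟨h.monotone_q, h.monotone_p, fun i j hj hj' hi e => ?_, fun i j hj hj' hi e => ?_⟩
    · rcases Nat.eq_zero_or_pos i with rfl | hi0
      · have h1 := h.special_a (by omega)
        rw [entry_eq] at h1
        rw [show j = 1 by omega, extend_zero]
        omega
      rcases Nat.lt_or_ge N j with hj1 | hj1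
      · have h1 := h.special_a' (by omega)
        rw [entry_eq] at h1
        rw [extend_of_lt q hj1, show i = N by omega]
        omega
      · have h1 := h.first i j hi0 hi hj hj1 e
        rw [entry_eq, entry_eq] at h1
        omega
    · rcases Nat.eq_zero_or_pos i with rfl | hi0
      · have h1 := h.special_b (by omega)
        rw [entry_eq] at h1
        rw [show j = 1 by omega, extend_zero]
        omega
      rcases Nat.lt_or_ge N j with hj1 | hj1
      · have h1 := h.special_b' (by omega)
        rw [entry_eq] at h1
        rw [extend_of_lt p hj1, show i = N by omega]
        omega
      · have h1 := h.second i j hi0 hi hj hj1 e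
        rw [entry_eq, entry_eq] at h1
        omega
  · rintro ⟨hq, hp, c1, c2⟩
    refine ⟨hq, hp, fun i j hi hi' hj hj' e => ?_, fun i j hi hi' hj hj' e => ?_, fun ha => ?_,
      fun hb => ?_, fun ha => ?_, fun hb => ?_⟩
    · have := c1 i j hj (by omega) hi' e
      rw [entry_eq, entry_eq]
      omega
    · have := c2 i j hj (by omega) hi' e
      rw [entry_eq, entry_eq]
      omega
    · have := c1 0 1 le_rfl (by omega) (by omega) (by omega)
      rw [extend_zero] at this
      rw [entry_eq]
      omega
    · have := c2 0 1 le_rfl (by omega) (by omega) (by omega)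
      rw [extend_zero] at this
      rw [entry_eq]
      omega
    · have := c1 N (N + 1) (by omega) le_rfl le_rfl (by omega)
      rw [extend_of_lt q (by omega)] at this
      rw [entry_eq]
      omega
    · have := c2 N (N + 1) (by omega) le_rfl le_rfl (by omega)
      rw [extend_of_lt p (by omega)] at this
      rw [entry_eq]
      omega

theorem R_eq_pairGen (N M a b α β : ℕ) :
    R N M a b α β = pairGen PowerSeries.X a b α β N M N M := by
  classical
  rw [R, genFun, ← finsum_mem_coe_finset, pairGen]
  refine finsum_mem_eq_of_bijOn (Prod.map extend extend) ⟨fun π hπ => ?_, ?_, fun π hπ => ?_⟩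
    (fun π _ => by simp [pathWt_extend])
  · have h := (isRestricted_iff π.1 π.2).1 (Finset.mem_filter.1 hπ).2
    exact ⟨isPath_extend h.1, isPath_extend h.2.1, h.2.2⟩
  · exact (Prod.map_injective.2 ⟨extend_injective, extend_injective⟩).injOn
  · obtain ⟨q, hq, hq'⟩ := hπ.1.exists_extend
    obtain ⟨p, hp, hp'⟩ := hπ.2.1.exists_extend
    refine ⟨(q, p), Finset.mem_filter.2 ⟨Finset.mem_univ _, (isRestricted_iff q p).2 ⟨hq, hp, ?_⟩⟩,
      Prod.ext hq' hp'⟩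
    rw [hq', hp']
    exact hπ.2.2

/-- `ℤ⟦X⟧` inside its field of fractions. -/
noncomputable def toFrac : ℤ⟦X⟧ →+* FractionRing ℤ⟦X⟧ := algebraMap _ _

theorem toFrac_injective : Function.Injective toFrac := IsFractionRing.injective _ _

theorem toFrac_X_ne_zero : toFrac PowerSeries.X ≠ 0 :=
  (map_ne_zero_iff _ toFrac_injective).2 PowerSeries.X_ne_zero

theorem X_pow_ne_one (j : ℕ) (hj : 0 < j) : (PowerSeries.X : ℤ⟦X⟧) ^ j ≠ 1 := by
  intro h
  have := congrArg PowerSeries.constantCoeff h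
  simp [hj.ne'] at this

theorem toFrac_X_pow_ne_one (j : ℕ) (hj : 0 < j) : toFrac PowerSeries.X ^ j ≠ 1 := by
  rw [← map_pow, ← map_one toFrac]
  exact toFrac_injective.ne (X_pow_ne_one j hj)

theorem toFrac_R {a b α β : ℕ} (hK : 0 < a + b) (hκ : 0 < α + β) {N M L : ℕ} (hL : M < L) :
    toFrac (R N M a b α β) =
      bosSum (toFrac PowerSeries.X) L (a + b) (α + β) a α N M N M := by
  rw [R_eq_pairGen, map_pairGen, pairGen_eq_bosSum toFrac_X_ne_zero hK hκ N M N M L hL]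
  all_goals omega

theorem R_swap {a b α β : ℕ} (hK : 0 < a + b) (hκ : 0 < α + β) (N M : ℕ) :
    R N M a b α β = R M N α β a b := by
  apply toFrac_injective
  rw [toFrac_R hK hκ (L := N + M + 1) (by omega), toFrac_R hκ hK (L := N + M + 1) (by omega),
    bosSum_swap]

/-- One subtraction step of the Euclidean algorithm, on `(α : a)` and `(β : b)` at once. -/
theorem R_burge {a b α β : ℕ} (hK : 0 < a + b) (hκ : 0 < α + β) (N M : ℕ) :
    R N M a b (α + a) (β + b) = ∑ n ∈ Finset.range (min N M + 1),
      PowerSeries.X ^ (n ^ 2) * boxGen PowerSeries.X (N - n) (2 * M) * R n (M - n) a b α β := by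
  apply toFrac_injective
  rw [toFrac_R hK (by omega) (L := M + 1) (by omega), map_sum]
  have h := bosSum_burge toFrac_X_ne_zero toFrac_X_pow_ne_one (M + 1) N M (K := a + b) (κ := α + β)
    (a := a) (α := α) (by omega) (by omega) (by omega) (by omega)
  rw [show ((α + a : ℕ) : ℤ) + (β + b : ℕ) = α + β + (a + b) by push_cast; ring,
    Nat.cast_add α a, h]
  symm
  -- Terms with `n > N` vanish; discarding them makes the natural-number subtraction `N - n` exact.
  refine Finset.sum_subset_zero_on_sdiff (Finset.range_subset_range.2 (by omega)) (fun n hn => ?_)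
    (fun n hn => ?_)
  · simp only [Finset.mem_sdiff, Finset.mem_range] at hn
    rw [intBox_of_neg_left _ (by omega), mul_zero, zero_mul]
  · rw [Finset.mem_range] at hn
    rw [map_mul, map_mul, map_boxGen, toFrac_R hK hκ (L := M + 1) (by omega), map_pow,
      Nat.cast_sub (by omega), ← Nat.cast_sub (show n ≤ N by omega),
      show (2 * M : ℤ) = (2 * M : ℕ) by push_cast; rfl, intBox_natCast, ← Nat.cast_pow,
      zpow_natCast]

theorem R_one_zero (b β N M : ℕ) :
    R N (M + 1) 1 b 0 (β + 1) = PowerSeries.X ^ N * R N M 1 b 1 β := by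
  apply toFrac_injective
  rw [map_mul, toFrac_R (by omega) (by omega) (L := M + 2) (by omega),
    toFrac_R (by omega) (by omega) (L := M + 2) (by omega)]
  have h := bosSum_one_zero toFrac_X_ne_zero (M + 2) (K := 1 + b) (κ := β + 1) (N := N) (M := M)
    (by omega) (by omega) (by omega) (by omega)
  push_cast
  rw [zero_add, h, add_comm (1 : ℤ) β]
  simp

theorem R_zero_one (b β N M : ℕ) :
    R (N + 1) M 0 (b + 1) 1 β = PowerSeries.X ^ M * R N M 1 b 1 β := by
  rw [R_swap (by omega) (by omega), R_one_zero, R_swap (by omega) (by omega)]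

theorem R_eq_zero {N M a b α β : ℕ}
    (h : ∀ π, π ∉ pairSet a b α β N M N M) : R N M a b α β = 0 := by
  rw [R_eq_pairGen, pairGen, Set.eq_empty_of_forall_notMem h, finsum_mem_empty]

/-- With empty boxes, the only possible pair is the trivial one. -/
theorem R_eq_one {N a b α β : ℕ} (h : ((fun _ => 0, fun _ => 0) : (ℕ → ℕ) × (ℕ → ℕ)) ∈
    pairSet a b α β N 0 N 0) : R N 0 a b α β = 1 := by
  rw [R_eq_pairGen, pairGen, show pairSet a b α β N 0 N 0 = {(fun _ => 0, fun _ => 0)} by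
    refine Set.eq_singleton_iff_unique_mem.2 ⟨h, fun π hπ => Prod.ext ?_ ?_⟩
    · exact funext fun i => Nat.le_zero.1 (hπ.1.le i)
    · exact funext fun i => Nat.le_zero.1 (hπ.2.1.le i), finsum_mem_singleton]
  simp [pathWt]

theorem isPath_const_zero (N : ℕ) : IsPath N 0 fun _ => 0 :=
  ⟨rfl, monotone_const, fun _ _ => rfl⟩

theorem R_zero_right (b β N : ℕ) (hβ : 0 < β) :
    R N 0 1 b 0 β = if N = 0 then 1 else 0 := by
  split_ifs with hN
  · subst hN
    refine R_eq_one ⟨isPath_const_zero 0, isPath_const_zero 0, fun i j _ _ _ _ => ?_,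
      fun i j _ _ _ _ => by simpa using hβ⟩
    omega
  · refine R_eq_zero fun π hπ => ?_
    have h1 := hπ.2.2.1 1 1 le_rfl (by omega) (by omega) rfl
    have h2 := hπ.2.1.le 1
    omega

theorem R_zero_left (b β M : ℕ) (hb : 0 < b) :
    R 0 M 0 b 1 β = if M = 0 then 1 else 0 := by
  rw [R_swap (by omega) (by omega), R_zero_right _ _ _ hb]

/-- The conditions give `f_{i+1} ≤ h_i ≤ f_i` for the pair `(f, h)`, so `f` stays at height `0`,
although it ends at height `M`. -/
theorem R_trivial (N M : ℕ) : R N M 0 1 1 1 = if M = 0 then 1 else 0 := by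
  split_ifs with hM
  · subst hM
    exact R_eq_one ⟨isPath_const_zero N, isPath_const_zero N, fun i j _ _ _ _ => by simp,
      fun i j _ _ _ _ => by simp⟩
  · refine R_eq_zero fun π hπ => hM ?_
    have key : ∀ i, i ≤ N → π.1 (i + 1) = 0 := by
      intro i
      induction i with
      | zero =>
        intro _
        have h1 := hπ.2.2.1 0 1 le_rfl (by omega) (by omega) rfl
        rw [hπ.2.1.zero] at h1
        exact Nat.lt_one_iff.1 h1
      | succ i ih =>
        intro hi
        have h1 := hπ.2.2.1 (i + 1) (i + 2) (by omega) (by omega) (by omega) rfl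
        have h2 := hπ.2.2.2 (i + 1) (i + 1) (by omega) (by omega) (by omega) rfl
        have h3 := ih (by omega)
        change π.1 (i + 2) = 0
        omega
    rw [← key N le_rfl, hπ.1.eq_top _ (by omega)]

/-! ### The normalized series -/

/-- The series `q ^ (-M) R(N, M, 0, K, 1, κ - 1)`. -/
noncomputable def S (N M K κ : ℕ) : ℤ⟦X⟧ :=
  if N = 0 then (if M = 0 then 1 else 0) else R (N - 1) M 1 (K - 1) 1 (κ - 1)

theorem S_succ (N M K κ : ℕ) : S (N + 1) M K κ = R N M 1 (K - 1) 1 (κ - 1) := by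
  simp [S]

theorem X_pow_mul_S {K κ : ℕ} (hK : 0 < K) (N M : ℕ) :
    PowerSeries.X ^ M * S N M K κ = R N M 0 K 1 (κ - 1) := by
  cases N with
  | zero =>
    rw [R_zero_left _ _ _ hK, S, if_pos rfl]
    split_ifs with h <;> simp [h]
  | succ N =>
    obtain ⟨K, rfl⟩ := Nat.exists_eq_succ_of_ne_zero hK.ne'
    rw [S_succ, R_zero_one]
    simp

/-- This swap is the source of the shifts by one in `n_{k,0}` and `w_k` for `k ≥ u + 2`. -/
theorem S_swap {K κ : ℕ} (N M : ℕ) :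
    S (N + 1) M K κ = S (M + 1) N κ K := by
  rw [S_succ, S_succ, R_swap (by omega) (by omega)]

theorem S_zero_left (M K κ : ℕ) : S 0 M K κ = if M = 0 then 1 else 0 := if_pos rfl

theorem S_trivial (N M : ℕ) : S N M 1 2 = if M = 0 then 1 else 0 := by
  have h := X_pow_mul_S (K := 1) (κ := 2) one_pos N M
  rw [R_trivial] at h
  split_ifs at h ⊢ with hM
  · simpa [hM] using h
  · exact (mul_eq_zero.1 h).resolve_left (pow_ne_zero _ PowerSeries.X_ne_zero)

/-- Dividing out `q^M` on one side and `q^(M - n)` on the other turns `n^2` into `n^2 + (M - n) - M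
= n (n - 1)`. -/
theorem S_burge {K κ : ℕ} (hK : 0 < K) (hκ : 0 < κ) (N M : ℕ) :
    S N M K (κ + K) = ∑ n ∈ Finset.range (min N M + 1),
      PowerSeries.X ^ (n * (n - 1)) * boxGen PowerSeries.X (N - n) (2 * M) * S n (M - n) K κ := by
  refine mul_left_cancel₀ (pow_ne_zero M (PowerSeries.X_ne_zero (R := ℤ))) ?_
  rw [X_pow_mul_S hK, show κ + K - 1 = κ - 1 + K by omega]
  have h := R_burge (a := 0) (b := K) (α := 1) (β := κ - 1) (by omega) (by omega) N M
  rw [add_zero] at h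
  rw [h, Finset.mul_sum]
  refine Finset.sum_congr rfl fun n hn => ?_
  rw [Finset.mem_range] at hn
  rw [← X_pow_mul_S hK]
  have e : n ^ 2 + (M - n) = M + n * (n - 1) := by
    cases n with
    | zero => simp
    | succ n =>
      rw [Nat.add_sub_cancel]
      have : (n + 1) ^ 2 = (n + 1) * n + (n + 1) := by ring
      omega
  calc _ = PowerSeries.X ^ (n ^ 2 + (M - n)) * boxGen PowerSeries.X (N - n) (2 * M) *
        S n (M - n) K κ := by rw [pow_add]; ring
    _ = _ := by rw [e, pow_add]; ring

/-! ### Values of continued fractions -/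

/-- The value of a continued fraction whose tail has the value `v`. -/
def cfVal (v : ℕ × ℕ) (l : List ℕ) : ℕ × ℕ := l.foldr (fun c v => (c * v.1 + v.2, v.1)) v

@[simp] theorem cfVal_nil (v : ℕ × ℕ) : cfVal v [] = v := rfl

@[simp] theorem cfVal_cons (v : ℕ × ℕ) (c : ℕ) (l : List ℕ) :
    cfVal v (c :: l) = (c * (cfVal v l).1 + (cfVal v l).2, (cfVal v l).1) := rfl

theorem cfVal_append (v : ℕ × ℕ) (l l' : List ℕ) : cfVal v (l ++ l') = cfVal (cfVal v l') l :=
  List.foldr_append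

/-- Linearity in the tail: writing the tail `(K, κ)` as `(1, 0) + (K - 1, κ)` splits `(p', p)` into
`(s, r)` and `(p' - s, p - r)`. -/
theorem cfVal_add (v v' : ℕ × ℕ) (l : List ℕ) :
    cfVal (v + v') l = cfVal v l + cfVal v' l := by
  induction l with
  | nil => rfl
  | cons c l ih =>
    simp only [cfVal_cons, ih, Prod.fst_add, Prod.snd_add, Prod.mk_add_mk]
    congr 1
    ring

theorem cfVal_pos {v : ℕ × ℕ} (h1 : 0 < v.1) (h2 : 0 < v.2) (l : List ℕ) :
    0 < (cfVal v l).1 ∧ 0 < (cfVal v l).2 := by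
  induction l with
  | nil => exact ⟨h1, h2⟩
  | cons c l ih => exact ⟨by rw [cfVal_cons]; exact Nat.add_pos_right _ ih.2, ih.1⟩

theorem cfVal_contFrac {s r : ℕ} (hs : 0 < s) (h : Nat.Coprime s r) :
    cfVal (1, 0) (contFrac s r) = (s, r) := by
  induction r using Nat.strong_induction_on generalizing s with
  | _ r ih =>
  cases r with
  | zero => rw [contFrac, cfVal_nil, (Nat.coprime_zero_right s).1 h]
  | succ r =>
    have h' : Nat.Coprime (r + 1) (s % (r + 1)) := by
      rw [Nat.coprime_comm, Nat.Coprime, ← Nat.gcd_rec, Nat.gcd_comm]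
      exact h
    rw [contFrac, cfVal_cons, ih _ (Nat.mod_lt _ (Nat.succ_pos r)) (Nat.succ_pos r) h']
    simp only [Prod.mk.injEq, and_true]
    exact Nat.div_add_mod' s (r + 1)

theorem IsContFrac.cfVal_eq {l : List ℕ} {s r : ℕ} (h : IsContFrac l s r) :
    cfVal (1, 0) l = (s, r) := by
  obtain ⟨hs, hc, rfl | ⟨l', a, rfl, h⟩⟩ := h
  · exact cfVal_contFrac hs hc
  · rw [← cfVal_contFrac hs hc, h, cfVal_append, cfVal_append]
    simp

/-! ### Lists built element by element -/

/-- The lists `a :: l` with `a ∈ L` and `l ∈ T a`. -/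
def consSigma {α : Type*} (L : Finset α) (T : α → Finset (List α)) : Finset (List α) :=
  (L.sigma T).map ⟨fun x => x.1 :: x.2, fun x y h => by
    obtain ⟨x1, x2⟩ := x
    obtain ⟨y1, y2⟩ := y
    simp only [List.cons.injEq] at h
    rw [h.1, h.2]⟩

theorem cons_mem_consSigma {α : Type*} {L : Finset α} {T : α → Finset (List α)} {a : α}
    {l : List α} : a :: l ∈ consSigma L T ↔ a ∈ L ∧ l ∈ T a := by
  simp only [consSigma, Finset.mem_map, Finset.mem_sigma]
  constructor
  · rintro ⟨⟨x1, x2⟩, ⟨h1, h2⟩, h⟩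
    obtain ⟨rfl, rfl⟩ := List.cons.inj h
    exact ⟨h1, h2⟩
  · rintro ⟨h1, h2⟩
    exact ⟨⟨a, l⟩, ⟨h1, h2⟩, rfl⟩

theorem nil_notMem_consSigma {α : Type*} {L : Finset α} {T : α → Finset (List α)} :
    [] ∉ consSigma L T := by
  simp [consSigma]

theorem sum_consSigma {α A : Type*} [AddCommMonoid A] (L : Finset α) (T : α → Finset (List α))
    (F : List α → A) : ∑ l ∈ consSigma L T, F l = ∑ a ∈ L, ∑ l ∈ T a, F (a :: l) := by
  rw [consSigma, Finset.sum_map, Finset.sum_sigma]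
  rfl

/-! ### Iterated summation formulas -/

/-- The partitions with `f` parts, all at most `N`, of weight at most `M`. -/
def level : ℕ → ℕ → ℕ → Finset (List ℕ)
  | 0, _, _ => {[]}
  | f + 1, N, M => consSigma (Finset.range (min N M + 1)) fun n => level f n (M - n)

/-- The weight of a partition in a summation formula iterated along its parts. -/
noncomputable def levelWt (e : ℕ → ℕ) : ℕ → ℕ → List ℕ → ℤ⟦X⟧
  | _, _, [] => 1
  | N, M, n :: l => PowerSeries.X ^ e n * boxGen PowerSeries.X (N - n) (2 * M) *
      levelWt e n (M - n) l

/-- Here `T j` stands for `R` or `S` with `j` Burge steps still to be undone; the successive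
summation indices are the parts of one partition. -/
theorem eq_sum_level (e : ℕ → ℕ) (T : ℕ → ℕ → ℕ → ℤ⟦X⟧)
    (hT : ∀ j N M, T (j + 1) N M = ∑ n ∈ Finset.range (min N M + 1),
      PowerSeries.X ^ e n * boxGen PowerSeries.X (N - n) (2 * M) * T j n (M - n)) (f N M : ℕ) :
    T f N M = ∑ l ∈ level f N M, levelWt e N M l * T 0 (l.getLastD N) (M - l.sum) := by
  induction f generalizing N M with
  | zero => simp [level, levelWt]
  | succ f ih =>
    rw [hT, level, sum_consSigma]
    refine Finset.sum_congr rfl fun n _ => ?_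
    rw [ih, Finset.mul_sum]
    refine Finset.sum_congr rfl fun l _ => ?_
    rw [levelWt, List.getLastD_cons, List.sum_cons, Nat.sub_sub]
    ring

/-- The partitions `n^{(k)}`, `k > u`, for given `(n_{u+1,0}, w_{u+1})`. -/
def upper : List ℕ → ℕ → ℕ → Finset (List (List ℕ))
  | [], _, _ => ∅
  | g :: gs, N, M => consSigma (level g N M) fun l =>
      if l.getLastD N = 0 ∨ gs = [] then (if M - l.sum = 0 then {[]} else ∅)
      else upper gs (M - l.sum + 1) (l.getLastD N - 1)

/-- The weight of a member of `upper`. -/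
noncomputable def upperWt : ℕ → ℕ → List (List ℕ) → ℤ⟦X⟧
  | _, _, [] => 1
  | N, M, l :: ν => levelWt (fun n => n * (n - 1)) N M l *
      upperWt (M - l.sum + 1) (l.getLastD N - 1) ν

theorem sum_ite_singleton_nil {α : Type*} (P : Prop) [Decidable P] (F : List α → ℤ⟦X⟧) :
    ∑ ν ∈ (if P then {[]} else ∅ : Finset (List α)), F ν = if P then F [] else 0 := by
  split_ifs <;> simp

/-- A quotient `g` costs `g` Burge steps, after which `S_swap` exposes the next quotient. The tail
`(1, 2)` is where `S_trivial` applies. -/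
theorem S_eq_sum_upper (g : ℕ) (gs : List ℕ) (N M : ℕ) :
    S N M (cfVal (1, 2) (g :: gs)).2 (cfVal (1, 2) (g :: gs)).1 =
      ∑ ν ∈ upper (g :: gs) N M, upperWt N M ν := by
  induction gs generalizing g N M with
  | nil =>
    have h := eq_sum_level (fun n => n * (n - 1)) (fun j N M => S N M 1 (2 + j * 1))
      (fun j N M => by
        rw [show 2 + (j + 1) * 1 = 2 + j * 1 + 1 by ring, S_burge one_pos (by omega)]) g N M
    simp only [cfVal_cons, cfVal_nil]
    rw [add_comm (g * 1), h, upper, sum_consSigma]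
    refine Finset.sum_congr rfl fun l _ => ?_
    rw [if_pos (Or.inr rfl), sum_ite_singleton_nil, S_trivial]
    simp [upperWt]
  | cons g' gs ih =>
    have hv := cfVal_pos (v := (1, 2)) one_pos two_pos (g' :: gs)
    rw [cfVal_cons _ g]
    simp only [upper, sum_consSigma] at ih ⊢
    set v := cfVal (1, 2) (g' :: gs)
    have h := eq_sum_level (fun n => n * (n - 1)) (fun j N M => S N M v.1 (v.2 + j * v.1))
      (fun j N M => by
        rw [show v.2 + (j + 1) * v.1 = v.2 + j * v.1 + v.1 by ring,
          S_burge hv.1 (by omega)]) g N M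
    rw [add_comm (g * v.1), h]
    refine Finset.sum_congr rfl fun l _ => ?_
    rw [zero_mul, add_zero]
    -- A vanishing last part stops the sequence early, because `S 0` is a delta in `M`; otherwise
    -- the swap is available.
    by_cases hl : l.getLastD N = 0
    · rw [if_pos (Or.inl hl), sum_ite_singleton_nil, hl, S_zero_left]
      simp [upperWt]
    · obtain ⟨m, hm⟩ := Nat.exists_eq_succ_of_ne_zero hl
      rw [if_neg (not_or.2 ⟨hl, List.cons_ne_nil _ _⟩), hm, S_swap, Nat.succ_sub_one,
        ih g', sum_consSigma,
        Finset.mul_sum]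
      refine Finset.sum_congr rfl fun l' _ => ?_
      rw [Finset.mul_sum]
      refine Finset.sum_congr rfl fun ν _ => ?_
      rw [show upperWt N M (l :: l' :: ν) = levelWt (fun n => n * (n - 1)) N M l *
        upperWt (M - l.sum + 1) (l.getLastD N - 1) (l' :: ν) by rw [upperWt], hm, Nat.succ_sub_one]

/-- The partitions `n^{(k)}`, for given `(n_{1,0}, w_1)`. -/
def lower (gs : List ℕ) : List ℕ → ℕ → ℕ → Finset (List (List ℕ))
  | [], _, _ => ∅
  | f :: fs, N, M => consSigma (level f N M) fun l =>
      if fs = [] then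
        if M - l.sum = 0 then (if l.getLastD N = 0 then {[]} else ∅)
        else upper gs (l.getLastD N + 1) (M - l.sum - 1)
      else lower gs fs (M - l.sum) (l.getLastD N)

/-- The weight of a member of `lower`. -/
noncomputable def lowerWt : List ℕ → ℕ → ℕ → List (List ℕ) → ℤ⟦X⟧
  | [], _, _, _ => 1
  | _, _, _, [] => 1
  | _ :: fs, N, M, l :: ν => levelWt (fun n => n ^ 2) N M l *
      if fs = [] then PowerSeries.X ^ l.getLastD N * upperWt (l.getLastD N + 1) (M - l.sum - 1) ν
      else lowerWt fs (M - l.sum) (l.getLastD N) ν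

/-- Euclid's algorithm on both pairs ends at `(1, K - 1, 0, κ)`. If no weight is left,
`R_zero_right` forces the last part to be `0`. Otherwise `R_one_zero` uses up one unit of weight,
gives the factor `q^(n_{u,d})`, and leaves `S` at `(n_{u,d} + 1, w - 1)`, with `w` the weight left
over. -/
theorem R_eq_sum_lower (g : ℕ) (gs : List ℕ) (f : ℕ) (fs : List ℕ) {K κ : ℕ}
    (hv : cfVal (1, 2) (g :: gs) = (κ, K)) (N M : ℕ) :
    R N M (cfVal (1, 0) (f :: fs)).2 (cfVal (K - 1, κ) (f :: fs)).2
      (cfVal (1, 0) (f :: fs)).1 (cfVal (K - 1, κ) (f :: fs)).1 =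
      ∑ ν ∈ lower (g :: gs) (f :: fs) N M, lowerWt (f :: fs) N M ν := by
  have hpos := cfVal_pos (v := (1, 2)) one_pos two_pos (g :: gs)
  rw [hv] at hpos
  obtain ⟨hκ, hK⟩ := hpos
  -- The sums `a + b` and `α + β` along the way are the entries of `cfVal (K, κ)`, hence positive.
  have hpos' : ∀ l, 0 < (cfVal (1, 0) l).1 + (cfVal (K - 1, κ) l).1 ∧
      0 < (cfVal (1, 0) l).2 + (cfVal (K - 1, κ) l).2 := fun l => by
    rw [← Prod.fst_add, ← Prod.snd_add, ← cfVal_add]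
    exact cfVal_pos (by simp) (by simpa using hκ) l
  induction fs generalizing f N M with
  | nil =>
    have h := eq_sum_level (fun n => n ^ 2)
      (fun j N M => R N M 1 (K - 1) (0 + j * 1) (κ + j * (K - 1)))
      (fun j N M => by
        rw [show 0 + (j + 1) * 1 = 0 + j * 1 + 1 by ring,
          show κ + (j + 1) * (K - 1) = κ + j * (K - 1) + (K - 1) by ring,
          R_burge (by omega) (by simp only at hκ; omega)]) f N M
    simp only [cfVal_cons, cfVal_nil]
    rw [add_comm (f * 1), add_comm (f * (K - 1)), h, lower, sum_consSigma]
    refine Finset.sum_congr rfl fun l _ => ?_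
    rw [if_pos rfl, zero_mul, zero_mul, add_zero, add_zero]
    by_cases hM : M - l.sum = 0
    · rw [if_pos hM, sum_ite_singleton_nil, hM, R_zero_right _ _ _ hκ]
      split_ifs with hl
      · rw [lowerWt, if_pos rfl, hl, upperWt, pow_zero]
        ring
      · simp
    · obtain ⟨m, hm⟩ := Nat.exists_eq_succ_of_ne_zero hM
      obtain ⟨k, rfl⟩ := Nat.exists_eq_succ_of_ne_zero hκ.ne'
      rw [if_neg hM, hm, Nat.succ_eq_add_one, Nat.succ_eq_add_one, R_one_zero, Nat.add_sub_cancel]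
      have h2 := S_eq_sum_upper g gs (l.getLastD N + 1) m
      rw [hv, S_succ] at h2
      simp only [Nat.succ_eq_add_one, Nat.add_sub_cancel] at h2
      rw [h2, Finset.mul_sum, Finset.mul_sum]
      refine Finset.sum_congr rfl fun ν _ => ?_
      rw [lowerWt, if_pos rfl, hm, Nat.succ_sub_one]
  | cons f' fs ih =>
    have hp := hpos' (f' :: fs)
    rw [cfVal_cons _ f, cfVal_cons _ f]
    rw [lower, sum_consSigma]
    set v := cfVal (1, 0) (f' :: fs) with hv1
    set v' := cfVal (K - 1, κ) (f' :: fs) with hv2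
    have h := eq_sum_level (fun n => n ^ 2)
      (fun j N M => R N M v.1 v'.1 (v.2 + j * v.1) (v'.2 + j * v'.1))
      (fun j N M => by
        rw [show v.2 + (j + 1) * v.1 = v.2 + j * v.1 + v.1 by ring,
          show v'.2 + (j + 1) * v'.1 = v'.2 + j * v'.1 + v'.1 by ring,
          R_burge (by omega) (by omega)]) f N M
    simp only
    rw [add_comm (f * v.1), add_comm (f * v'.1), h]
    refine Finset.sum_congr rfl fun l _ => ?_
    rw [zero_mul, zero_mul, add_zero, add_zero, R_swap hp.1 hp.2, ih, if_neg (by simp),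
      Finset.mul_sum]
    refine Finset.sum_congr rfl fun ν _ => ?_
    rw [lowerWt, if_neg (by simp)]

/-! ### Admissible sequences, one partition at a time -/

theorem mem_level {f N M : ℕ} {l : List ℕ} : l ∈ level f N M ↔
    l.length = f ∧ (∀ i < f, l.getD i 0 ≤ (N :: l).getD i 0) ∧ l.sum ≤ M := by
  induction f generalizing N M l with
  | zero =>
    rw [level, Finset.mem_singleton]
    constructor
    · rintro rfl
      simp
    · exact fun h => List.length_eq_zero_iff.1 h.1
  | succ f ih =>
    cases l with
    | nil => simp [level, nil_notMem_consSigma]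
    | cons n l =>
      rw [level, cons_mem_consSigma, ih, Finset.mem_range, List.length_cons, List.sum_cons,
        Nat.add_right_cancel_iff]
      constructor
      · rintro ⟨h1, h2, h3, h4⟩
        refine ⟨h2, fun i hi => ?_, by omega⟩
        cases i with
        | zero => simp only [List.getD_cons_zero]; omega
        | succ i => simpa only [List.getD_cons_succ] using h3 i (by omega)
      · rintro ⟨h2, h3, h4⟩
        have h5 := h3 0 (by omega)
        simp only [List.getD_cons_zero] at h5
        refine ⟨by omega, h2, fun i hi => ?_, by omega⟩
        simpa only [List.getD_cons_succ] using h3 (i + 1) (by omega)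

theorem getD_length_sub_one {l : List ℕ} (h : l.length ≠ 0) (N : ℕ) :
    l.getD (l.length - 1) 0 = l.getLastD N := by
  induction l generalizing N with
  | nil => simp at h
  | cons a l ih =>
    rw [List.getLastD_cons]
    cases l with
    | nil => rfl
    | cons b l => exact ih (by simp) a

/-! ### The recursion defining `lower` and `upper` matches the admissibility conditions. -/

section

variable (M₀ t : ℕ) (f : ℕ → ℕ) (u : ℕ) (ν : List (List ℕ))

/-- `(n_{k,0}, w_k)` is `(N, M)`; for `k = 1`, where `n_{1,0} = ∞`, it suffices that `M ≤ N`. -/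
structure AtLevel (k N M : ℕ) : Prop where
  one_le : 1 ≤ k
  weight : w ⊤ M₀ f u ν k = M
  top : k = 1 → f 1 ≠ 0 ∧ M ≤ N
  bound : k ≠ 1 → n ⊤ M₀ f u ν k 0 = N

/-- The conditions on the partition `n^{(k)}` alone. -/
structure LevelOK (k : ℕ) : Prop where
  length : (prt ν k).length = f k
  antitone : ∀ i, 1 ≤ i → i ≤ f k → n ⊤ M₀ f u ν k i ≤ n ⊤ M₀ f u ν k (i - 1)
  wt_le : ((prt ν k).sum : ℕ∞) ≤ w ⊤ M₀ f u ν k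

/-- The conditions of `IsAdmissible` that concern the partitions `n^{(j)}` with `j ≥ k`. -/
structure TailOK (k : ℕ) : Prop where
  le : k ≤ ν.length
  le_length : u ≤ ν.length
  length_le : ν.length ≤ t + 1
  level : ∀ j, k ≤ j → j ≤ ν.length → LevelOK M₀ f u ν j
  wt_last : ((prt ν ν.length).sum : ℕ∞) = w ⊤ M₀ f u ν ν.length
  wt_u : k ≤ u → u < ν.length → ((prt ν u).sum : ℕ∞) < w ⊤ M₀ f u ν u
  pos : ∀ j, k ≤ j → u < j → j < ν.length → 0 < n ⊤ M₀ f u ν j (f j)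
  zero : ν.length < t + 1 → n ⊤ M₀ f u ν ν.length (f ν.length) = 0

variable {M₀ t f u ν}

theorem isAdmissible_iff (hu : 1 ≤ u) : IsAdmissible ⊤ M₀ t f u ν ↔ TailOK M₀ t f u ν 1 := by
  constructor
  · intro h
    exact ⟨hu.trans h.le_length, h.le_length, h.length_le,
      fun j hj hj' => ⟨h.length_prt j hj hj', fun i => h.antitone j i hj hj', h.wt_le j hj hj'⟩,
      h.wt_last, fun _ => h.wt_u, fun j _ => h.pos j, h.zero⟩
  · intro h
    exact ⟨h.le_length, h.length_le, fun j hj hj' => (h.level j hj hj').length,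
      fun j i hj hj' => (h.level j hj hj').antitone i, fun j hj hj' => (h.level j hj hj').wt_le,
      h.wt_last, h.wt_u hu, fun j hj => h.pos j (by omega) hj, h.zero⟩

theorem n_succ (k i : ℕ) : n ⊤ M₀ f u ν k (i + 1) = ((prt ν k).getD i 0 : ℕ) := rfl

theorem AtLevel.n_eq {k N M : ℕ} (h : AtLevel M₀ f u ν k N M) {i : ℕ} (hi : i ≠ 0 ∨ k ≠ 1) :
    n ⊤ M₀ f u ν k i = ((N :: prt ν k).getD i 0 : ℕ) := by
  cases i with
  | zero => exact h.bound (by omega)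
  | succ i => rfl

theorem AtLevel.mem_level_iff {k N M : ℕ} (h : AtLevel M₀ f u ν k N M) :
    prt ν k ∈ BurgeTree.level (f k) N M ↔ LevelOK M₀ f u ν k := by
  rw [mem_level]
  have hw : ((prt ν k).sum : ℕ∞) ≤ w ⊤ M₀ f u ν k ↔ (prt ν k).sum ≤ M := by
    rw [h.weight, Nat.cast_le]
  constructor
  · rintro ⟨h1, h2, h3⟩
    refine ⟨h1, fun i hi hi' => ?_, hw.2 h3⟩
    obtain ⟨i, rfl⟩ := Nat.exists_eq_succ_of_ne_zero (show i ≠ 0 by omega)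
    by_cases hik : i ≠ 0 ∨ k ≠ 1
    · rw [Nat.succ_sub_one, h.n_eq hik, Nat.succ_eq_add_one, n_succ, Nat.cast_le]
      exact h2 i (by omega)
    · push Not at hik
      obtain ⟨rfl, rfl⟩ := hik
      exact le_top
  · rintro ⟨h1, h2, h3⟩
    refine ⟨h1, fun i hi => ?_, hw.1 h3⟩
    by_cases hik : i ≠ 0 ∨ k ≠ 1
    · have := h2 (i + 1) (by omega) (by omega)
      rwa [Nat.add_sub_cancel, h.n_eq hik, n_succ, Nat.cast_le] at this
    · push Not at hik
      obtain ⟨rfl, rfl⟩ := hik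
      -- For `k = 1` the bound `n_{1,1} ≤ ∞` is as strong as `n_{1,1} ≤ N`, because the weight is at
      -- most `M ≤ N`.
      refine le_trans ?_ ((hw.1 h3).trans (h.top rfl).2)
      cases hp : prt ν 1 with
      | nil => simp
      | cons a l => simp

/-- An empty partition (`f_k = 0`) has `n_{k,0}` as its last part. For `k = 1` this is excluded, so
the infinite bound is never read. -/
theorem AtLevel.n_last {k N M : ℕ} (h : AtLevel M₀ f u ν k N M) (hl : (prt ν k).length = f k) :
    n ⊤ M₀ f u ν k (f k) = ((prt ν k).getLastD N : ℕ) := by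
  by_cases hf : f k = 0
  · rw [hf] at hl ⊢
    rw [h.n_eq (Or.inr fun hk => (h.top hk).1 (hk ▸ hf)), List.length_eq_zero_iff.1 hl]
    rfl
  · rw [← getD_length_sub_one (hl ▸ hf), hl]
    obtain ⟨i, hi⟩ := Nat.exists_eq_succ_of_ne_zero hf
    rw [hi]
    rfl

theorem bounds_succ {k : ℕ} (hk : 1 ≤ k) : bounds ⊤ M₀ f u ν (k + 1) =
    if k + 1 ≤ u then (w ⊤ M₀ f u ν k - (prt ν k).sum, n ⊤ M₀ f u ν k (f k))
    else if k + 1 = u + 1 then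
      (n ⊤ M₀ f u ν k (f k) + 1, w ⊤ M₀ f u ν k - 1 - (prt ν k).sum)
    else (w ⊤ M₀ f u ν k + 1 - (prt ν k).sum, n ⊤ M₀ f u ν k (f k) - 1) := by
  obtain ⟨k, rfl⟩ := Nat.exists_eq_succ_of_ne_zero (show k ≠ 0 by omega)
  rfl

theorem AtLevel.next_of_lt {k N M : ℕ} (h : AtLevel M₀ f u ν k N M) (hl : LevelOK M₀ f u ν k)
    (hk : k < u) :
    AtLevel M₀ f u ν (k + 1) (M - (prt ν k).sum) ((prt ν k).getLastD N) := by
  have hb := bounds_succ (M₀ := M₀) (f := f) (u := u) (ν := ν) h.one_le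
  rw [if_pos (by omega), h.weight, h.n_last hl.length] at hb
  refine ⟨by omega, congrArg Prod.snd hb, fun h' => ?_, fun _ => ?_⟩
  · have := h.one_le
    omega
  · exact (congrArg Prod.fst hb).trans (ENat.natCast_sub _ _).symm

theorem AtLevel.next_of_eq {N M : ℕ} (h : AtLevel M₀ f u ν u N M) (hl : LevelOK M₀ f u ν u) :
    AtLevel M₀ f u ν (u + 1) ((prt ν u).getLastD N + 1) (M - (prt ν u).sum - 1) := by
  have hb := bounds_succ (M₀ := M₀) (f := f) (u := u) (ν := ν) h.one_le
  rw [if_neg (by omega), if_pos rfl, h.weight, h.n_last hl.length] at hb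
  refine ⟨by omega, ?_, fun h' => ?_, fun _ => congrArg Prod.fst hb⟩
  · refine (congrArg Prod.snd hb).trans ?_
    rw [Nat.sub_right_comm]
    push_cast
    rfl
  · have := h.one_le
    omega

theorem AtLevel.next_of_gt {k N M : ℕ} (h : AtLevel M₀ f u ν k N M) (hl : LevelOK M₀ f u ν k)
    (hk : u < k) :
    AtLevel M₀ f u ν (k + 1) (M - (prt ν k).sum + 1) ((prt ν k).getLastD N - 1) := by
  have hb := bounds_succ (M₀ := M₀) (f := f) (u := u) (ν := ν) h.one_le
  rw [if_neg (by omega), if_neg (by omega), h.weight, h.n_last hl.length] at hb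
  -- Truncated subtraction: `M + 1 - wt = M - wt + 1` needs `wt ≤ M`.
  have hw : (prt ν k).sum ≤ M := by
    have := hl.wt_le
    rwa [h.weight, Nat.cast_le] at this
  refine ⟨by omega, ?_, fun h' => ?_, fun _ => ?_⟩
  · refine (congrArg Prod.snd hb).trans ?_
    push_cast
    rfl
  · have := h.one_le
    omega
  · refine (congrArg Prod.fst hb).trans ?_
    rw [← Nat.sub_add_comm hw]
    push_cast
    rfl

theorem drop_eq_cons {k : ℕ} (hk : 1 ≤ k) (h : k ≤ ν.length) :
    ν.drop (k - 1) = prt ν k :: ν.drop k := by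
  have h1 : k - 1 < ν.length := by omega
  rw [List.drop_eq_getElem_cons h1, prt, List.getD_eq_getElem _ _ h1, Nat.sub_add_cancel hk]

theorem AtLevel.sum_eq_iff {k N M : ℕ} (h : AtLevel M₀ f u ν k N M) (hl : LevelOK M₀ f u ν k) :
    ((prt ν k).sum : ℕ∞) = w ⊤ M₀ f u ν k ↔ M - (prt ν k).sum = 0 := by
  have := hl.wt_le
  rw [h.weight, Nat.cast_le] at this
  rw [h.weight, Nat.cast_inj]
  omega

theorem AtLevel.n_last_eq_zero_iff {k N M : ℕ} (h : AtLevel M₀ f u ν k N M)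
    (hl : LevelOK M₀ f u ν k) :
    n ⊤ M₀ f u ν k (f k) = 0 ↔ (prt ν k).getLastD N = 0 := by
  rw [h.n_last hl.length, Nat.cast_eq_zero]

theorem nil_notMem_upper (gs : List ℕ) (N M : ℕ) : [] ∉ upper gs N M := by
  cases gs with
  | nil => simp [upper]
  | cons g gs => exact nil_notMem_consSigma

theorem nil_notMem_lower (gs fs : List ℕ) (N M : ℕ) : [] ∉ lower gs fs N M := by
  cases fs with
  | nil => simp [lower]
  | cons g gs => exact nil_notMem_consSigma

theorem mem_ite_singleton_nil {α : Type*} (P : Prop) [Decidable P] (l : List α) :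
    l ∈ (if P then {[]} else ∅ : Finset (List α)) ↔ l = [] ∧ P := by
  split_ifs with h <;> simp [h]

theorem TailOK.of_length {k : ℕ} (hl : LevelOK M₀ f u ν k) (hk : k = ν.length) (hu : u ≤ k)
    (ht : k ≤ t + 1) (h1 : ((prt ν k).sum : ℕ∞) = w ⊤ M₀ f u ν k)
    (h2 : k < t + 1 → n ⊤ M₀ f u ν k (f k) = 0) : TailOK M₀ t f u ν k := by
  subst hk
  exact ⟨le_rfl, hu, ht, fun j hj hj' => le_antisymm hj hj' ▸ hl, h1, fun _ _ => by omega,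
    fun j _ _ _ => by omega, h2⟩

theorem tailOK_iff_of_lt {k : ℕ} (hk : k < ν.length) : TailOK M₀ t f u ν k ↔
    LevelOK M₀ f u ν k ∧ (k = u → ((prt ν u).sum : ℕ∞) < w ⊤ M₀ f u ν u) ∧
      (u < k → 0 < n ⊤ M₀ f u ν k (f k)) ∧ TailOK M₀ t f u ν (k + 1) := by
  constructor
  · intro h
    exact ⟨h.level k le_rfl h.le, fun e => h.wt_u (by omega) (by omega),
      fun hu => h.pos k le_rfl hu hk, hk, h.le_length, h.length_le,
      fun j hj => h.level j (by omega), h.wt_last, fun hj => h.wt_u (by omega),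
      fun j hj => h.pos j (by omega), h.zero⟩
  · rintro ⟨h1, h2, h3, h⟩
    refine ⟨hk.le, h.le_length, h.length_le, fun j hj hj' => ?_, h.wt_last, fun hu hu' => ?_,
      fun j hj hj' hj'' => ?_, h.zero⟩
    · rcases Nat.eq_or_lt_of_le hj with rfl | hj
      · exact h1
      · exact h.level j hj hj'
    · rcases Nat.eq_or_lt_of_le hu with rfl | hu
      · exact h2 rfl
      · exact h.wt_u hu hu'
    · rcases Nat.eq_or_lt_of_le hj with rfl | hj
      · exact h3 hj'
      · exact h.pos j hj hj' hj''

/-- Induction on the number of stages still allowed. At stage `t + 1`, or after a zero last part,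
the sequence stops and must have used all its weight; otherwise `next_of_gt` supplies the next
stage. -/
theorem mem_upper_iff {k N M : ℕ} (hk : u < k) (hkt : k ≤ t + 1) (h : AtLevel M₀ f u ν k N M) :
    ν.drop (k - 1) ∈ upper ((List.range' k (t + 2 - k)).map f) N M ↔ TailOK M₀ t f u ν k := by
  obtain ⟨j, hj⟩ : ∃ j, t + 1 = k + j := Nat.exists_eq_add_of_le hkt
  rw [show t + 2 - k = j + 1 by omega]
  by_cases hlen : k ≤ ν.length
  swap
  · rw [List.drop_eq_nil_of_le (by omega)]
    exact iff_of_false (nil_notMem_upper _ _ _) fun h' => hlen h'.le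
  induction j generalizing k N M with
  | zero =>
    rw [List.range'_succ, List.map_cons, List.range'_zero, List.map_nil, upper,
      drop_eq_cons h.one_le hlen, cons_mem_consSigma, h.mem_level_iff, if_pos (Or.inr rfl),
      mem_ite_singleton_nil, List.drop_eq_nil_iff]
    constructor
    · rintro ⟨h1, h2, h3⟩
      exact TailOK.of_length h1 (le_antisymm hlen h2) hk.le hkt ((h.sum_eq_iff h1).2 h3)
        fun _ => by omega
    · intro h'
      have e : k = ν.length := by have := h'.length_le; omega
      have h1 := h'.level k le_rfl hlen
      refine ⟨h1, e.ge, (h.sum_eq_iff h1).1 ?_⟩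
      rw [e]
      exact h'.wt_last
  | succ j ih =>
    rw [List.range'_succ, List.map_cons, upper, drop_eq_cons h.one_le hlen, cons_mem_consSigma,
      h.mem_level_iff]
    have hne : (List.range' (k + 1) (j + 1)).map f ≠ [] := by simp
    rcases Nat.eq_or_lt_of_le hlen with e | hlt
    · rw [List.drop_eq_nil_of_le e.ge]
      constructor
      · rintro ⟨h1, h2⟩
        by_cases hz : (prt ν k).getLastD N = 0
        · rw [if_pos (Or.inl hz), mem_ite_singleton_nil] at h2
          exact TailOK.of_length h1 e hk.le hkt ((h.sum_eq_iff h1).2 h2.2)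
            fun _ => (h.n_last_eq_zero_iff h1).2 hz
        · rw [if_neg (not_or.2 ⟨hz, hne⟩)] at h2
          exact absurd h2 (nil_notMem_upper _ _ _)
      · intro h'
        have h1 := h'.level k le_rfl hlen
        have h2 := h'.zero (by omega)
        have h3 := h'.wt_last
        rw [← e] at h2 h3
        refine ⟨h1, ?_⟩
        rw [if_pos (Or.inl ((h.n_last_eq_zero_iff h1).1 h2)), mem_ite_singleton_nil]
        exact ⟨rfl, (h.sum_eq_iff h1).1 h3⟩
    · rw [tailOK_iff_of_lt hlt]
      refine and_congr_right fun h1 => ?_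
      have hdrop : ν.drop k ≠ [] := by simpa using hlt
      have h0 : 0 < n ⊤ M₀ f u ν k (f k) ↔ ¬ (prt ν k).getLastD N = 0 := by
        rw [pos_iff_ne_zero, ne_eq, h.n_last_eq_zero_iff h1]
      rw [h0]
      by_cases hz : (prt ν k).getLastD N = 0
      · rw [if_pos (Or.inl hz), mem_ite_singleton_nil]
        simp only [hdrop, false_and, false_iff]
        exact fun h' => h'.2.1 hk hz
      · have := ih (by omega) (by omega) (h.next_of_gt h1 hk) (by omega) hlt
        rw [Nat.add_sub_cancel] at this
        rw [if_neg (not_or.2 ⟨hz, hne⟩), this]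
        exact ⟨fun h' => ⟨fun e => by omega, fun _ => hz, h'⟩, fun h' => h'.2.2⟩

/-- Induction on `u - k`. No sequence stops before stage `u`; there it stops exactly when the weight
is exhausted, and otherwise passes to `upper`. -/
theorem mem_lower_iff {k N M : ℕ} (hk : k ≤ u) (hut : u ≤ t) (h : AtLevel M₀ f u ν k N M) :
    ν.drop (k - 1) ∈ lower ((List.range' (u + 1) (t + 1 - u)).map f)
      ((List.range' k (u + 1 - k)).map f) N M ↔ TailOK M₀ t f u ν k := by
  obtain ⟨j, hj⟩ := Nat.exists_eq_add_of_le hk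
  rw [show u + 1 - k = j + 1 by omega]
  by_cases hlen : k ≤ ν.length
  swap
  · rw [List.drop_eq_nil_of_le (by omega)]
    exact iff_of_false (nil_notMem_lower _ _ _ _) fun h' => hlen h'.le
  induction j generalizing k N M with
  | zero =>
    obtain rfl : u = k := by omega
    rw [List.range'_succ, List.map_cons, List.range'_zero, List.map_nil, lower,
      drop_eq_cons h.one_le hlen, cons_mem_consSigma, h.mem_level_iff, if_pos rfl]
    rcases Nat.eq_or_lt_of_le hlen with e | hlt
    · rw [List.drop_eq_nil_of_le e.ge]
      constructor
      · rintro ⟨h1, h2⟩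
        by_cases hM : M - (prt ν u).sum = 0
        · rw [if_pos hM, mem_ite_singleton_nil] at h2
          exact TailOK.of_length h1 e hk (by omega) ((h.sum_eq_iff h1).2 hM)
            fun _ => (h.n_last_eq_zero_iff h1).2 h2.2
        · rw [if_neg hM] at h2
          exact absurd h2 (nil_notMem_upper _ _ _)
      · intro h'
        have h1 := h'.level u le_rfl hlen
        have h2 := h'.zero (by omega)
        have h3 := h'.wt_last
        rw [← e] at h2 h3
        refine ⟨h1, ?_⟩
        rw [if_pos ((h.sum_eq_iff h1).1 h3), mem_ite_singleton_nil]
        exact ⟨rfl, (h.n_last_eq_zero_iff h1).1 h2⟩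
    · rw [tailOK_iff_of_lt hlt]
      refine and_congr_right fun h1 => ?_
      have hdrop : ν.drop u ≠ [] := by simpa using hlt
      have h0 : ((prt ν u).sum : ℕ∞) < w ⊤ M₀ f u ν u ↔ ¬ M - (prt ν u).sum = 0 := by
        rw [lt_iff_le_and_ne, ne_eq, h.sum_eq_iff h1]
        exact and_iff_right h1.wt_le
      rw [h0]
      by_cases hz : M - (prt ν u).sum = 0
      · rw [if_pos hz, mem_ite_singleton_nil]
        simp only [hdrop, false_and, false_iff]
        exact fun h' => h'.1 trivial hz
      · have := mem_upper_iff (t := t) (Nat.lt_succ_self u) (by omega) (h.next_of_eq h1)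
        rw [Nat.succ_eq_add_one, Nat.add_sub_cancel, show t + 2 - (u + 1) = t + 1 - u by omega]
          at this
        rw [if_neg hz, this]
        exact ⟨fun h' => ⟨fun _ => hz, fun e => by omega, h'⟩, fun h' => h'.2.2⟩
  | succ j ih =>
    have hne : (List.range' (k + 1) (j + 1)).map f ≠ [] := by simp
    rw [List.range'_succ, List.map_cons, lower, drop_eq_cons h.one_le hlen, cons_mem_consSigma,
      h.mem_level_iff, if_neg hne]
    rcases Nat.eq_or_lt_of_le hlen with e | hlt
    · rw [List.drop_eq_nil_of_le e.ge]
      refine iff_of_false (fun h' => nil_notMem_lower _ _ _ _ h'.2) fun h' => ?_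
      have := h'.le_length
      omega
    · rw [tailOK_iff_of_lt hlt]
      refine and_congr_right fun h1 => ?_
      have := ih (by omega) (h.next_of_lt h1 (by omega)) (by omega) hlt
      rw [Nat.add_sub_cancel] at this
      rw [this]
      exact ⟨fun h' => ⟨fun e => by omega, fun e => by omega, h'⟩, fun h' => h'.2.2⟩

end

/-! ### The summands of the fermionic sum -/

theorem constantCoeff_qFact (n : ℕ) : PowerSeries.constantCoeff (qFact n) = 1 := by
  rw [qFact, map_prod]
  refine Finset.prod_eq_one fun j hj => ?_
  have : j ≠ 0 := by have := (Finset.mem_Icc.1 hj).1; omega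
  simp [this]

theorem qFact_mul_qFactInv (n : ℕ) : qFact n * qFactInv n = 1 :=
  PowerSeries.mul_invOfUnit _ _ (by simp [constantCoeff_qFact])

theorem gauss_eq_boxGen {P N : ℕ} (h : N ≤ P) : gauss P N = boxGen PowerSeries.X N (P - N) := by
  have h1 : boxGen PowerSeries.X N (P - N) * qFact N * qFact (P - N) = qFact (N + (P - N)) :=
    boxGen_mul_qPoch_mul_qPoch _ _ _
  rw [gauss, if_pos h, ← Nat.add_sub_cancel' h, ← h1, Nat.add_sub_cancel_left]
  linear_combination boxGen PowerSeries.X N (P - N) * qFact (P - N) * qFactInv (P - N) *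
    qFact_mul_qFactInv N + boxGen PowerSeries.X N (P - N) * qFact_mul_qFactInv (P - N)

theorem prod_Icc_one {A : Type*} [CommMonoid A] (F : ℕ → A) (m : ℕ) :
    ∏ i ∈ Finset.Icc 1 m, F i = ∏ i ∈ Finset.range m, F (i + 1) := by
  induction m with
  | zero => simp
  | succ m ih => rw [Finset.prod_Icc_succ_top (by omega), Finset.prod_range_succ, ih]

theorem sum_Icc_one {A : Type*} [AddCommMonoid A] (F : ℕ → A) (m : ℕ) :
    ∑ i ∈ Finset.Icc 1 m, F i = ∑ i ∈ Finset.range m, F (i + 1) := by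
  induction m with
  | zero => simp
  | succ m ih => rw [Finset.sum_Icc_succ_top (by omega), Finset.sum_range_succ, ih]

theorem sum_range_getD_le (l : List ℕ) (m : ℕ) : ∑ i ∈ Finset.range m, l.getD i 0 ≤ l.sum := by
  induction l generalizing m with
  | nil => simp
  | cons a l ih =>
    cases m with
    | zero => simp
    | succ m =>
      rw [Finset.sum_range_succ', List.sum_cons, List.getD_cons_zero, add_comm]
      simpa only [List.getD_cons_succ] using Nat.add_le_add_left (ih m) a

theorem levelWt_eq (e : ℕ → ℕ) (N M : ℕ) (l : List ℕ) : levelWt e N M l =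
    PowerSeries.X ^ (∑ i ∈ Finset.range l.length, e (l.getD i 0)) *
      ∏ i ∈ Finset.range l.length, boxGen PowerSeries.X ((N :: l).getD i 0 - l.getD i 0)
        (2 * (M - ∑ j ∈ Finset.range i, l.getD j 0)) := by
  induction l generalizing N M with
  | nil => simp [levelWt]
  | cons a l ih =>
    rw [levelWt, ih, List.length_cons, Finset.sum_range_succ', Finset.prod_range_succ']
    simp only [List.getD_cons_succ, List.getD_cons_zero, Finset.range_zero, Finset.sum_empty,
      Nat.sub_zero, Finset.sum_range_succ', pow_add]
    have : ∀ i, M - (∑ j ∈ Finset.range i, l.getD j 0 + a) =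
        M - a - ∑ j ∈ Finset.range i, l.getD j 0 := fun i => by omega
    simp only [this]
    ring

section

variable {M₀ t : ℕ} {f : ℕ → ℕ} {u : ℕ} {ν : List (List ℕ)}

/-- Top minus bottom of the Gaussian is `2 (w_k - ∑_{j ≤ i} n_{k,j}) + 2 n_{k,i} = 2 (w_k - ∑_{j <
i} n_{k,j})`, twice the weight left before the `i`-th part. -/
theorem AtLevel.gaussFactor_eq {k N M i : ℕ} (h : AtLevel M₀ f u ν k N M)
    (hl : LevelOK M₀ f u ν k) (hi : i ≠ 0 ∨ k ≠ 1) (hik : i < f k) :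
    gaussFactor ⊤ M₀ f u ν k (i + 1) =
      boxGen PowerSeries.X ((N :: prt ν k).getD i 0 - (prt ν k).getD i 0)
        (2 * (M - ∑ j ∈ Finset.range i, (prt ν k).getD j 0)) := by
  obtain ⟨h1, h2, h3⟩ := mem_level.1 (h.mem_level_iff.2 hl)
  have h4 := h2 i hik
  have h5 := (sum_range_getD_le (prt ν k) (i + 1)).trans h3
  rw [Finset.sum_range_succ] at h5
  rw [gaussFactor, Nat.add_sub_cancel, h.n_eq hi, h.weight, sum_Icc_one, Finset.sum_range_succ]
  simp only [part, Nat.add_sub_cancel, ENat.toNat_natCast]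
  rw [gauss_eq_boxGen (by omega)]
  congr 1
  omega

/-- For `k = 1` the first Gaussian, the only factor that depends on `N`, is split off, since `term`
omits it. -/
theorem AtLevel.levelWt_prt {k N M : ℕ} (h : AtLevel M₀ f u ν k N M) (hl : LevelOK M₀ f u ν k)
    (e : ℕ → ℕ) : levelWt e N M (prt ν k) =
      (if k = 1 then boxGen PowerSeries.X (N - part ν 1 1) (2 * M) else 1) *
      (PowerSeries.X ^ (∑ i ∈ Finset.Icc 1 (f k), e (part ν k i)) *
        ∏ i ∈ Finset.Icc (if k = 1 then 2 else 1) (f k), gaussFactor ⊤ M₀ f u ν k i) := by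
  rw [levelWt_eq, hl.length, sum_Icc_one]
  simp only [part, Nat.add_sub_cancel]
  by_cases hk : k = 1
  · subst hk
    obtain ⟨m, hm⟩ := Nat.exists_eq_succ_of_ne_zero (h.top rfl).1
    have h1 : Finset.Icc 1 (f 1) = insert 1 (Finset.Icc 2 (f 1)) := by
      ext x
      simp only [Finset.mem_Icc, Finset.mem_insert]
      omega
    have h2 : ∏ i ∈ Finset.Icc 2 (f 1), gaussFactor ⊤ M₀ f u ν 1 i =
        ∏ i ∈ Finset.Icc 2 (f 1), boxGen PowerSeries.X
          ((N :: prt ν 1).getD (i - 1) 0 - (prt ν 1).getD (i - 1) 0)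
          (2 * (M - ∑ j ∈ Finset.range (i - 1), (prt ν 1).getD j 0)) := by
      refine Finset.prod_congr rfl fun i hi => ?_
      rw [Finset.mem_Icc] at hi
      rw [← h.gaussFactor_eq hl (by omega) (by omega), Nat.sub_add_cancel (by omega)]
    have h3 := prod_Icc_one (fun i => boxGen PowerSeries.X
          ((N :: prt ν 1).getD (i - 1) 0 - (prt ν 1).getD (i - 1) 0)
          (2 * (M - ∑ j ∈ Finset.range (i - 1), (prt ν 1).getD j 0)) : ℕ → ℤ⟦X⟧) (f 1)
    simp only [Nat.add_sub_cancel] at h3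
    rw [if_pos rfl, if_pos rfl, h2, ← h3, h1, Finset.prod_insert (by simp)]
    simp only [Nat.sub_self, List.getD_cons_zero, Finset.range_zero, Finset.sum_empty, Nat.sub_zero]
    ring
  · rw [if_neg hk, if_neg hk, one_mul, prod_Icc_one]
    congr 1
    exact Finset.prod_congr rfl fun i hi =>
      (h.gaussFactor_eq hl (Or.inr hk) (Finset.mem_range.1 hi)).symm

/-- The contribution of the partition `n^{(k)}` to the summand for `ν`. -/
noncomputable def levelTerm (e : ℕ → ℕ) (M₀ : ℕ) (f : ℕ → ℕ) (u : ℕ) (ν : List (List ℕ)) (k : ℕ) :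
    ℤ⟦X⟧ :=
  PowerSeries.X ^ (∑ i ∈ Finset.Icc 1 (f k), e (part ν k i)) *
    ∏ i ∈ Finset.Icc (if k = 1 then 2 else 1) (f k), gaussFactor ⊤ M₀ f u ν k i

theorem prod_Icc_eq_mul {A : Type*} [CommMonoid A] (F : ℕ → A) {a b : ℕ} (h : a ≤ b) :
    ∏ i ∈ Finset.Icc a b, F i = F a * ∏ i ∈ Finset.Icc (a + 1) b, F i := by
  have : Finset.Icc a b = insert a (Finset.Icc (a + 1) b) := by
    ext x
    simp only [Finset.mem_Icc, Finset.mem_insert]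
    omega
  rw [this, Finset.prod_insert (by simp)]

theorem upperWt_drop {k N M : ℕ} (hu : 1 ≤ u) (hk : u < k) (h : AtLevel M₀ f u ν k N M)
    (hT : TailOK M₀ t f u ν k) : upperWt N M (ν.drop (k - 1)) =
      ∏ j ∈ Finset.Icc k ν.length, levelTerm (fun n => n * (n - 1)) M₀ f u ν j := by
  obtain ⟨m, hm⟩ := Nat.exists_eq_add_of_le hT.le
  induction m generalizing k N M with
  | zero =>
    rw [drop_eq_cons h.one_le hT.le, List.drop_eq_nil_of_le (by omega), upperWt, upperWt,
      h.levelWt_prt (hT.level k le_rfl hT.le), if_neg (by omega), hm]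
    simp [levelTerm]
  | succ m ih =>
    have h1 := hT.level k le_rfl hT.le
    have h2 := ih (by omega) (h.next_of_gt h1 hk)
      ((tailOK_iff_of_lt (by omega)).1 hT).2.2.2 (by omega)
    rw [Nat.add_sub_cancel] at h2
    rw [drop_eq_cons h.one_le hT.le, upperWt, h2, h.levelWt_prt h1, if_neg (by omega),
      prod_Icc_eq_mul _ hT.le, one_mul]
    rfl

theorem lowerWt_drop {k N M : ℕ} (hk : k ≤ u) (hfu : f u ≠ 0) (h : AtLevel M₀ f u ν k N M)
    (hT : TailOK M₀ t f u ν k) :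
    lowerWt ((List.range' k (u + 1 - k)).map f) N M (ν.drop (k - 1)) =
      (if k = 1 then boxGen PowerSeries.X (N - part ν 1 1) (2 * M) else 1) *
      (PowerSeries.X ^ part ν u (f u) *
        (∏ j ∈ Finset.Icc k u, levelTerm (fun n => n ^ 2) M₀ f u ν j) *
        ∏ j ∈ Finset.Icc (u + 1) ν.length, levelTerm (fun n => n * (n - 1)) M₀ f u ν j) := by
  obtain ⟨m, hm⟩ := Nat.exists_eq_add_of_le hk
  rw [show u + 1 - k = m + 1 by omega]
  induction m generalizing k N M with
  | zero =>
    obtain rfl : u = k := by omega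
    have h1 := hT.level u le_rfl hT.le
    have hlast : (prt ν u).getLastD N = part ν u (f u) := by
      rw [← getD_length_sub_one (h1.length ▸ hfu), h1.length, part]
    rw [List.range'_succ, List.map_cons, drop_eq_cons h.one_le hT.le, lowerWt, h.levelWt_prt h1,
      List.range'_zero, List.map_nil, if_pos rfl, Finset.Icc_self, Finset.prod_singleton, hlast]
    have h2 : upperWt (part ν u (f u) + 1) (M - (prt ν u).sum - 1) (ν.drop u) =
        ∏ j ∈ Finset.Icc (u + 1) ν.length, levelTerm (fun n => n * (n - 1)) M₀ f u ν j := by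
      rcases Nat.eq_or_lt_of_le hT.le with e | hlt
      · rw [List.drop_eq_nil_of_le e.ge, upperWt, Finset.Icc_eq_empty (by omega), Finset.prod_empty]
      · rw [← hlast]
        exact upperWt_drop h.one_le (Nat.lt_succ_self u) (h.next_of_eq h1)
          ((tailOK_iff_of_lt hlt).1 hT).2.2.2
    rw [h2, levelTerm]
    ring
  | succ m ih =>
    have hlt : k < ν.length := by have := hT.le_length; omega
    have h1 := hT.level k le_rfl hT.le
    have h3 := ih (by omega) (h.next_of_lt h1 (by omega)) ((tailOK_iff_of_lt hlt).1 hT).2.2.2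
      (by omega)
    rw [Nat.add_sub_cancel, if_neg (show k + 1 ≠ 1 by have := h.one_le; omega), one_mul] at h3
    rw [List.range'_succ, List.map_cons, drop_eq_cons h.one_le hT.le, lowerWt, h.levelWt_prt h1,
      if_neg (show (List.range' (k + 1) (m + 1)).map f ≠ [] by simp), h3, prod_Icc_eq_mul _ hk,
      levelTerm]
    ring

theorem lowerWt_eq {N : ℕ} (hu : 1 ≤ u) (hfu : f u ≠ 0) (hf1 : f 1 ≠ 0) (hN : M₀ ≤ N)
    (hT : TailOK M₀ t f u ν 1) :
    lowerWt ((List.range' 1 u).map f) N M₀ ν =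
      boxGen PowerSeries.X (N - part ν 1 1) (2 * M₀) * term ⊤ M₀ f u (f u) ν := by
  have h : AtLevel M₀ f u ν 1 N M₀ := ⟨le_rfl, rfl, fun _ => ⟨hf1, hN⟩, fun h => absurd rfl h⟩
  have h1 := lowerWt_drop hu hfu h hT
  rw [Nat.add_sub_cancel, Nat.sub_self, List.drop_zero, if_pos rfl] at h1
  rw [h1]
  congr 1
  have hsplit : Finset.Icc 1 ν.length = Finset.Icc 1 u ∪ Finset.Icc (u + 1) ν.length := by
    ext x
    have := hT.le_length
    simp only [Finset.mem_Icc, Finset.mem_union]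
    omega
  have hdisj : Disjoint (Finset.Icc 1 u) (Finset.Icc (u + 1) ν.length) := by
    rw [Finset.disjoint_left]
    intro x hx
    simp only [Finset.mem_Icc] at hx ⊢
    omega
  -- The stages `k ≤ u` carry squares and the later ones `n (n - 1)`, so products and exponents are
  -- cut at `u`.
  rw [term, hsplit, Finset.prod_union hdisj, qExponent, pow_add, pow_add,
    ← Finset.prod_pow_eq_pow_sum, ← Finset.prod_pow_eq_pow_sum]
  simp only [levelTerm, Finset.prod_mul_distrib]
  ring

end

/-! ### The limit and the main theorem -/

/-- The Gaussian is `∏_{j ≤ m} (1 - q^(N - k + j))` over `(q)_m` once `N ≥ k`, and the numerator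
tends to `1`. -/
theorem tendsto_boxGen (k m : ℕ) :
    Tendsto (fun N : ℕ => boxGen (PowerSeries.X : ℤ⟦X⟧) (N - k) m) atTop (𝓝 (qFactInv m)) := by
  have hX : Tendsto (fun N : ℕ => (PowerSeries.X : ℤ⟦X⟧) ^ N) atTop (𝓝 0) :=
    PowerSeries.WithPiTopology.isTopologicallyNilpotent_of_constantCoeff_zero
      PowerSeries.constantCoeff_X
  have h1 : ∀ N, boxGen (PowerSeries.X : ℤ⟦X⟧) N m =
      (∏ j ∈ Finset.Icc 1 m, (1 - PowerSeries.X ^ (N + j))) * qFactInv m := fun N => by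
    rw [← boxGen_mul_qPoch, mul_assoc, show qPoch (PowerSeries.X : ℤ⟦X⟧) m = qFact m from rfl,
      qFact_mul_qFactInv, mul_one]
  have h2 : Tendsto (fun N : ℕ => boxGen (PowerSeries.X : ℤ⟦X⟧) N m) atTop (𝓝 (qFactInv m)) := by
    simp only [h1]
    have h3 : Tendsto (fun N : ℕ => ∏ j ∈ Finset.Icc 1 m, (1 - (PowerSeries.X : ℤ⟦X⟧) ^ (N + j)))
        atTop (𝓝 (∏ j ∈ Finset.Icc 1 m, (1 - 0))) :=
      tendsto_finsetProd _ fun j _ => tendsto_const_nhds.sub (hX.comp (tendsto_add_atTop_nat j))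
    simpa using h3.mul_const (qFactInv m)
  exact h2.comp (tendsto_sub_atTop_nat k)

theorem map_fSeq_lower (c : ℕ → ℕ) {u : ℕ} (hu : 1 ≤ u) (d : ℕ) :
    (List.range' 1 u).map (fSeq c u d) = (List.range' 1 (u - 1)).map c ++ [d] := by
  obtain ⟨m, rfl⟩ := Nat.exists_eq_succ_of_ne_zero (show u ≠ 0 by omega)
  rw [Nat.succ_eq_add_one, List.range'_1_concat, List.map_append, Nat.add_sub_cancel]
  congr 1
  · refine List.map_congr_left fun k hk => ?_
    rw [List.mem_range'_1] at hk
    rw [fSeq, if_pos (by omega)]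
  · rw [List.map_singleton, fSeq, if_neg (by omega), if_pos (by omega)]

theorem map_fSeq_upper (c : ℕ → ℕ) {u t : ℕ} (hut : u ≤ t) (d : ℕ) :
    (List.range' (u + 1) (t + 1 - u)).map (fSeq c u d) =
      (c u - d) :: (List.range' (u + 1) (t - u)).map c := by
  rw [show t + 1 - u = t - u + 1 by omega, List.range'_succ, List.map_cons]
  congr 1
  · rw [fSeq, if_neg (by omega), if_neg (by omega), if_pos rfl]
  · rw [List.range'_eq_map_range, List.range'_eq_map_range, List.map_map, List.map_map]
    refine List.map_congr_left fun k _ => ?_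
    simp only [Function.comp_apply]
    rw [fSeq, if_neg (by omega), if_neg (by omega), if_neg (by omega)]
    congr 1
    omega

/-- A last quotient `c_t + 2` has the same value as `c_t` followed by the tail `(1, 2)`, the pair at
which `S` is trivial. -/
theorem cfVal_last_add_two (c : ℕ → ℕ) {t : ℕ} (ht : 1 ≤ t) :
    cfVal (1, 0) ((List.range' 1 (t - 1)).map c ++ [c t + 2]) =
      cfVal (1, 2) ((List.range' 1 t).map c) := by
  obtain ⟨m, rfl⟩ := Nat.exists_eq_succ_of_ne_zero (show t ≠ 0 by omega)
  rw [Nat.succ_eq_add_one, Nat.add_sub_cancel, List.range'_1_concat, List.map_append, cfVal_append,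
    cfVal_append, add_comm 1 m]
  simp

/-- The continued fraction splits at the `d`-th step of its `u`-th stage. -/
theorem cfVal_split (c : ℕ → ℕ) {u t d : ℕ} (hu : 1 ≤ u) (hut : u ≤ t) (hd : d ≤ c u) :
    cfVal (1, 2) ((List.range' 1 t).map c) =
      cfVal (cfVal (1, 2) ((List.range' (u + 1) (t + 1 - u)).map (fSeq c u d))).swap
        ((List.range' 1 u).map (fSeq c u d)) := by
  rw [map_fSeq_lower c hu, map_fSeq_upper c hut]
  have h : List.range' 1 t = List.range' 1 (u - 1) ++ u :: List.range' (u + 1) (t - u) := by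
    rw [← List.range'_succ, show t = u - 1 + (t - u + 1) by omega, ← List.range'_append_1]
    congr 2 <;> omega
  rw [h, List.map_append, List.map_cons, cfVal_append, cfVal_append]
  congr 1
  obtain ⟨e, he⟩ := Nat.exists_eq_add_of_le hd
  rw [he, Nat.add_sub_cancel_left]
  simp
  ring

theorem contFrac_head {s r a : ℕ} {l : List ℕ} (hr : 0 < r) (hrs : r < s)
    (h : contFrac s r = a :: l) : a ≠ 0 := by
  obtain ⟨r, rfl⟩ := Nat.exists_eq_succ_of_ne_zero hr.ne'
  rw [contFrac] at h
  rw [← (List.cons.inj h).1]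
  exact (Nat.div_pos hrs.le hr).ne'

/-- The first partition must be nonempty so that `n_{1,0} = ∞` never serves as a last part. For `u =
1` this is `d ≥ 1`; for `u > 1` it is `c_1 ≥ 1`, from `p < p'`. -/
theorem fSeq_one_ne_zero {p p' t u d : ℕ} {c : ℕ → ℕ} (hp : 0 < p) (hpp' : p < p')
    (hc : IsContFrac ((List.range' 1 (t - 1)).map c ++ [c t + 2]) p' p) (hu : 1 ≤ u) (hut : u ≤ t)
    (hd : 1 ≤ d) : fSeq c u d 1 ≠ 0 := by
  unfold fSeq
  split_ifs with h1 h2 h3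
  · obtain ⟨-, -, h | ⟨l', a, h, -⟩⟩ := hc
    · rw [show t - 1 = t - 2 + 1 by omega, List.range'_succ, List.map_cons, List.cons_append] at h
      exact contFrac_head hp hpp' h
    -- A list ending in `c_t + 2` cannot end in `1`, so the identification of continued fractions
    -- plays no role.
    · have := congrArg List.getLast? h
      simp at this
  · omega
  all_goals omega

end BurgeTree

theorem mainTheorem9 (p p' : ℕ) (hp : 0 < p) (hpp' : p < p') (hcop : Nat.Coprime p p')
    (t : ℕ) (ht : 1 ≤ t) (c : ℕ → ℕ)
    (hc : BurgeTree.IsContFrac ((List.range' 1 (t - 1)).map c ++ [c t + 2]) p' p)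
    (u d : ℕ) (hu1 : 1 ≤ u) (hut : u ≤ t) (hd1 : 1 ≤ d) (hdc : d ≤ c u)
    (r s : ℕ)
    (hrs : BurgeTree.IsContFrac ((List.range' 1 (u - 1)).map c ++ [d]) s r)
    (M : ℕ) :
    {ν | BurgeTree.IsAdmissible ⊤ M t (BurgeTree.fSeq c u d) u ν}.Finite ∧
    Tendsto (fun N : ℕ => BurgeTree.R N M r (p - r) s (p' - s)) atTop
      (𝓝 (BurgeTree.qFactInv (2 * M) *
        ∑ᶠ ν ∈ {ν | BurgeTree.IsAdmissible ⊤ M t (BurgeTree.fSeq c u d) u ν},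
          BurgeTree.term ⊤ M (BurgeTree.fSeq c u d) u d ν)) := by
  open BurgeTree in
  set f := fSeq c u d with hf
  have hf1 : f 1 ≠ 0 := fSeq_one_ne_zero hp hpp' hc hu1 hut hd1
  have hfu : f u = d := by rw [hf, fSeq, if_neg (by omega), if_pos rfl]
  set fs := (List.range' 1 u).map f with hfs
  set gs := (List.range' (u + 1) (t + 1 - u)).map f with hgs
  obtain ⟨⟨κ, K⟩, hv⟩ : ∃ v, cfVal (1, 2) gs = v := ⟨_, rfl⟩
  have hp'p : cfVal (K, κ) fs = (p', p) := by
    rw [← hc.cfVal_eq, cfVal_last_add_two c ht, cfVal_split c hu1 hut hdc, ← hf, ← hgs, ← hfs, hv]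
    rfl
  have hsr : cfVal (1, 0) fs = (s, r) := by
    rw [← hrs.cfVal_eq, hfs, hf, map_fSeq_lower c hu1]
  have hpos := cfVal_pos (v := (1, 2)) one_pos two_pos gs
  rw [hv] at hpos
  -- Subtract the value for the tail `(1, 0)` from the value for `(K, κ)`.
  have hcomp : cfVal (K - 1, κ) fs = (p' - s, p - r) := by
    have h := cfVal_add (1, 0) (K - 1, κ) fs
    rw [Prod.mk_add_mk, Nat.add_sub_cancel' hpos.2, zero_add, hp'p, hsr] at h
    have h1 := congrArg Prod.fst h
    have h2 := congrArg Prod.snd h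
    simp only [Prod.fst_add, Prod.snd_add] at h1 h2
    rw [h1, h2, Nat.add_sub_cancel_left, Nat.add_sub_cancel_left]
  have hfs' : fs = f 1 :: (List.range' 2 (u - 1)).map f := by
    rw [hfs, show u = u - 1 + 1 by omega, List.range'_succ]
    rfl
  have hgs' : gs = f (u + 1) :: (List.range' (u + 2) (t - u)).map f := by
    rw [hgs, show t + 1 - u = t - u + 1 by omega, List.range'_succ]
    rfl
  have hR : ∀ N, R N M r (p - r) s (p' - s) = ∑ ν ∈ lower gs fs N M, lowerWt fs N M ν := by
    intro N
    have h := R_eq_sum_lower (f (u + 1)) ((List.range' (u + 2) (t - u)).map f) (f 1)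
      ((List.range' 2 (u - 1)).map f) (K := K) (κ := κ) (by rw [← hgs', hv]) N M
    rwa [← hgs', ← hfs', hsr, hcomp] at h
  have hmem : ∀ N, M ≤ N → ∀ ν, ν ∈ lower gs fs N M ↔ IsAdmissible ⊤ M t f u ν := by
    intro N hN ν
    rw [isAdmissible_iff hu1, ← mem_lower_iff (N := N) hu1 hut
      ⟨le_rfl, rfl, fun _ => ⟨hf1, hN⟩, fun h => absurd rfl h⟩]
    rfl
  -- Admissibility does not involve `N`, so `N = M` already gives the whole index set, and with it
  -- finiteness.
  have hset : {ν | IsAdmissible ⊤ M t f u ν} = ↑(lower gs fs M M) := by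
    ext ν
    exact (hmem M le_rfl ν).symm
  rw [hset]
  refine ⟨Finset.finite_toSet _, ?_⟩
  rw [finsum_mem_coe_finset, Finset.mul_sum]
  -- From `N = M` on, the index set is fixed and the limit can be taken term by term.
  have hev : ∀ᶠ N in atTop, ∑ ν ∈ lower gs fs M M,
      boxGen PowerSeries.X (N - part ν 1 1) (2 * M) * term ⊤ M f u d ν =
      R N M r (p - r) s (p' - s) := by
    filter_upwards [eventually_ge_atTop M] with N hN
    rw [hR, show lower gs fs N M = lower gs fs M M by
      ext ν
      rw [hmem N hN, hmem M le_rfl]]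
    refine Finset.sum_congr rfl fun ν hν => ?_
    rw [hmem M le_rfl, isAdmissible_iff hu1] at hν
    rw [hfs, lowerWt_eq hu1 (by omega) hf1 hN hν, hfu]
  refine Tendsto.congr' hev ?_
  exact tendsto_finsetSum _ fun ν _ => (tendsto_boxGen _ _).mul_const _
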